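/- Let $d\in\{2,3\}$ and let $\Omega\subset\mathbb{R}^d$ be a bounded open set with Lipschitz boundary. Let $\Gamma_1,\Gamma_2$ be disjoint relatively open subsets of $\partial\Omega$ with $\partial\Omega=\overline{\Gamma}_1\cup\overline{\Gamma}_2$, and let $H_{\Gamma_1}(\Omega):=\{v\in H^1(\Omega)^d: v=0\text{ on }\Gamma_1\}$. Let $\nu>0$ be a constant, and let $\mathbb{K}:\Omega\to\mathbb{R}^{d\times d}$ be bounded, measurable, symmetric and positive definite, with constants $\mathbb{K}_*,\mathbb{K}^*>0$ such that $$\mathbb{K}_*\|v\|_{0,\Omega}^2\le(\mathbb{K}^{-1}v,v)_{0,\Omega}\le\mathbb{K}^*\|v\|_{0,\Omega}^2\qquad\forall v\in H_{\Gamma_1}(\Omega).$$ Let $k\ge1$ and let $\{\mathcal{T}_h\}$ be a shape regular family of meshes: each $\mathcal{T}_h$ is a finite set of closed triangles (tetrahedra if $d=3$) with pairwise disjoint interiors and union $\overline\Omega$ (hanging nodes are allowed), and there is $\sigma>0$ such that $h_T\le\sigma\rho_T$ for every element $T$ of every mesh, where $h_T$ is the diameter of $T$ and $\rho_T$ is the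 largest diameter of a ball in $T$. Interior facets are the sets $F=T\cap T'$ of positive $(d-1)$-dimensional measure with $T\neq T'$ in $\mathcal{T}_h$. Boundary facets are the edges (faces if $d=3$) of elements that lie in $\partial\Omega$. It is assumed that, for $j=1,2$, the union of the boundary facets contained in $\overline{\Gamma}_j$ is $\overline{\Gamma}_j$. Let $\mathcal{F}_h^*$ be the set of all interior facets and of the boundary facets contained in $\overline{\Gamma}_1$, and let $h_{\mathcal F}$ be equal to the diameter of $F$ on each facet $F$. Let $$\mathcal{V}_h:=\{v\in L^2(\Omega)^d: v|_T\in\mathcal{P}_k(T)^d\ \forall T\in\mathcal{T}_h\},\qquad \mathcal{Q}_h:=\{q\in L^2(\Omega): q|_T\in\mathcal{P}_{k-1}(T)\ \forall T\in\mathcal{T}_h\}$$ (real-valued functions), and let $\nabla_h,\operatorname{div}_h$ be the elementwise gradient and divergence. On an interior facet $F=T\cap T'$ let $\{w\}=\frac12(w_T+w_{T'})$, $[\![v]\!]=v_T\otimes n_T+v_{T'}\otimes n_{T'}$ and $[\![\underline{v}]\!]=v_T\cdot n_T+v_{T'}\cdot n_{T'}$, with outward unit normals $n_T,n_{T'}$;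 on a boundary facet of $T$ let $\{w\}=w_T$, $[\![v]\!]=v_T\otimes n_T$ and $[\![\underline{v}]\!]=v_T\cdot n_T$. For $\texttt{a}_S>0$ and $\varepsilon\in\{-1,0,1\}$ put $$a_h(u,v):=\int_\Omega\mathbb{K}^{-1}u\cdot v+\int_\Omega\nu\nabla_hu:\nabla_hv+\int_{\mathcal{F}_h^*}\frac{\texttt{a}_S}{h_{\mathcal F}}\nu[\![u]\!]:[\![v]\!]-\int_{\mathcal{F}_h^*}\{\nu\nabla_hu\}:[\![v]\!]-\varepsilon\int_{\mathcal{F}_h^*}\{\nu\nabla_hv\}:[\![u]\!],$$ $$b_h(v,q):=-\int_\Omega q\,\operatorname{div}_hv+\int_{\mathcal{F}_h^*}\{q\}[\![\underline{v}]\!],\qquad \mathcal{K}_h:=\{v\in\mathcal{V}_h: b_h(v,q)=0\ \ \forall q\in\mathcal{Q}_h\},$$ $$\|v\|_{\mathcal{V}(h)}^2:=\|v\|_{0,\Omega}^2+\|\nabla_hv\|_{0,\Omega}^2+\|h_{\mathcal F}^{-1/2}[\![v]\!]\|_{0,\mathcal{F}_h^*}^2.$$ Then for every $\varepsilon\in\{-1,0,1\}$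 there exists $\texttt{a}^*>0$, independent of $h$, such that for every $\texttt{a}_S\ge\texttt{a}^*$ there exists $\widehat\alpha>0$, independent of $h$, such that for all meshes $\mathcal{T}_h$ of the family $$a_h(v_h,v_h)\ge\widehat\alpha\,\|v_h\|_{\mathcal{V}(h)}^2\qquad\forall v_h\in\mathcal{K}_h.$$ -/

import Mathlib

open MeasureTheory Matrix
open scoped ContDiff

namespace BrinkmanDG

noncomputable section

/-- The Euclidean space `ℝ^d`. -/
abbrev Pt (d : ℕ) := EuclideanSpace ℝ (Fin d)

/-! ### Domain, boundary parts, permeability -/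

/-- The boundary of `Ω` is locally the graph of a Lipschitz function, with `Ω` strictly above the
graph. Here `e` is the vertical direction, and `γ` does not depend on the coordinate along `e`. -/
def HasLipschitzBoundary {d : ℕ} (Ω : Set (Pt d)) : Prop :=
  ∀ x ∈ frontier Ω, ∃ e : Pt d, ‖e‖ = 1 ∧ ∃ r : ℝ, 0 < r ∧ ∃ (L : NNReal) (γ : Pt d → ℝ),
    LipschitzWith L γ ∧ (∀ (y : Pt d) (t : ℝ), γ (y + t • e) = γ y) ∧
      ∀ y ∈ Metric.ball x r, (y ∈ Ω ↔ γ y < inner ℝ e y)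

/-- `Γ₁`, `Γ₂` are disjoint, relatively open subsets of `∂Ω` whose closures cover `∂Ω`. -/
structure IsBoundaryPartition {d : ℕ} (Ω Γ₁ Γ₂ : Set (Pt d)) : Prop where
  open_left : ∃ U : Set (Pt d), IsOpen U ∧ Γ₁ = U ∩ frontier Ω
  open_right : ∃ U : Set (Pt d), IsOpen U ∧ Γ₂ = U ∩ frontier Ω
  disjoint : Disjoint Γ₁ Γ₂
  cover : frontier Ω = closure Γ₁ ∪ closure Γ₂

/-- The integration by parts identity `∫_Ω v_i ∂_j φ = - ∫_Ω G_ij φ` for one test function. -/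
def IntegratesByParts {d : ℕ} (Ω : Set (Pt d)) (v : Pt d → Fin d → ℝ)
    (G : Pt d → Matrix (Fin d) (Fin d) ℝ) (φ : Pt d → ℝ) : Prop :=
  ∀ i j, ∫ x in Ω, v x i * fderiv ℝ φ x (EuclideanSpace.single j 1) = - ∫ x in Ω, G x i j * φ x

/-- The space `H_{Γ₁}(Ω)`: vector fields in `L²(Ω)` with a weak gradient `G` in `L²(Ω)` and zero
trace on `Γ₁`. By Green's formula on a Lipschitz domain, the trace vanishes on `Γ₁` iff integration
by parts produces no boundary term for any smooth test function on `ℝ^d` whose (compact) support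
meets `∂Ω` only inside `Γ₁`. -/
def MemHGamma {d : ℕ} (Ω Γ₁ : Set (Pt d)) (v : Pt d → Fin d → ℝ) : Prop :=
  (∀ i, MemLp (fun x => v x i) 2 (volume.restrict Ω)) ∧
  ∃ G : Pt d → Matrix (Fin d) (Fin d) ℝ,
    (∀ i j, MemLp (fun x => G x i j) 2 (volume.restrict Ω)) ∧
    (∀ φ : Pt d → ℝ, ContDiff ℝ ∞ φ → HasCompactSupport φ → tsupport φ ⊆ Ω →
      IntegratesByParts Ω v G φ) ∧
    (∀ φ : Pt d → ℝ, ContDiff ℝ ∞ φ → HasCompactSupport φ →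
      Disjoint (tsupport φ) (frontier Ω \ Γ₁) → IntegratesByParts Ω v G φ)

/-- `perm` is a bounded, symmetric, positive definite permeability tensor on `Ω`, and
`κlo ‖v‖² ≤ (perm⁻¹ v, v) ≤ κup ‖v‖²` in `L²(Ω)` for all `v ∈ H_{Γ₁}(Ω)`. -/
structure IsPermeability {d : ℕ} (Ω Γ₁ : Set (Pt d)) (perm : Pt d → Matrix (Fin d) (Fin d) ℝ)
    (κlo κup : ℝ) : Prop where
  measurable : ∀ i j, AEMeasurable (fun x => perm x i j) (volume.restrict Ω)
  bounded : ∃ M : ℝ, ∀ᵐ x ∂(volume.restrict Ω), ∀ i j, |perm x i j| ≤ M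
  posDef : ∀ᵐ x ∂(volume.restrict Ω), (perm x).PosDef
  lower_pos : 0 < κlo
  upper_pos : 0 < κup
  lower : ∀ v : Pt d → Fin d → ℝ, MemHGamma Ω Γ₁ v →
    κlo * ∫ x in Ω, v x ⬝ᵥ v x ≤ ∫ x in Ω, ((perm x)⁻¹ *ᵥ v x) ⬝ᵥ v x
  upper : ∀ v : Pt d → Fin d → ℝ, MemHGamma Ω Γ₁ v →
    ∫ x in Ω, ((perm x)⁻¹ *ᵥ v x) ⬝ᵥ v x ≤ κup * ∫ x in Ω, v x ⬝ᵥ v x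

/-! ### Meshes and facets -/

/-- A subdivision of the closure of `Ω` into finitely many closed triangles / tetrahedra with
pairwise disjoint interiors. Hanging nodes are allowed. -/
structure Mesh {d : ℕ} (Ω : Set (Pt d)) where
  elems : Finset (Affine.Simplex ℝ (Pt d) d)
  cover : ⋃ T ∈ elems, T.closedInterior = closure Ω
  disjoint_interior : ∀ T ∈ elems, ∀ T' ∈ elems, T ≠ T' →
    Disjoint (interior T.closedInterior) (interior T'.closedInterior)

/-- The edge / face of the simplex `T` opposite to its vertex number `i`. -/
def simplexFacet {d : ℕ} (T : Affine.Simplex ℝ (Pt d) d) (i : Fin (d + 1)) : Set (Pt d) :=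
  convexHull ℝ (T.points '' {i}ᶜ)

namespace Mesh

variable {d : ℕ} {Ω : Set (Pt d)}

/-- Interior facets: intersections `T ∩ T'` of two distinct elements that have positive
`(d-1)`-dimensional measure. -/
def interiorFacets (𝒯 : Mesh Ω) : Set (Set (Pt d)) :=
  {F | 0 < μHE[d - 1] F ∧
    ∃ T ∈ 𝒯.elems, ∃ T' ∈ 𝒯.elems, T ≠ T' ∧ F = T.closedInterior ∩ T'.closedInterior}

/-- Boundary facets: edges / faces of elements that lie in `∂Ω`. -/
def boundaryFacets (𝒯 : Mesh Ω) : Set (Set (Pt d)) :=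
  {F | F ⊆ frontier Ω ∧ ∃ T ∈ 𝒯.elems, ∃ i, F = simplexFacet T i}

/-- Boundary facets that lie in (the closure of) the part `Γ` of the boundary. -/
def boundaryFacetsIn (𝒯 : Mesh Ω) (Γ : Set (Pt d)) : Set (Set (Pt d)) :=
  {F | F ∈ 𝒯.boundaryFacets ∧ F ⊆ closure Γ}

/-- The boundary mesh is compatible with the splitting of `∂Ω` into `Γ₁` and `Γ₂`. -/
def IsCompatible (𝒯 : Mesh Ω) (Γ₁ Γ₂ : Set (Pt d)) : Prop :=
  ⋃₀ 𝒯.boundaryFacetsIn Γ₁ = closure Γ₁ ∧ ⋃₀ 𝒯.boundaryFacetsIn Γ₂ = closure Γ₂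

theorem activeFacets_finite (𝒯 : Mesh Ω) (Γ₁ : Set (Pt d)) :
    (𝒯.interiorFacets ∪ 𝒯.boundaryFacetsIn Γ₁).Finite := by
  refine Set.Finite.union ?_ ?_
  · refine ((𝒯.elems ×ˢ 𝒯.elems).finite_toSet.image
      (fun p => p.1.closedInterior ∩ p.2.closedInterior)).subset ?_
    rintro F ⟨-, T, hT, T', hT', -, rfl⟩
    exact ⟨(T, T'), by simp [hT, hT'], rfl⟩
  · refine ((𝒯.elems ×ˢ (Finset.univ : Finset (Fin (d + 1)))).finite_toSet.image
      (fun p => simplexFacet p.1 p.2)).subset ?_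
    rintro F ⟨⟨-, T, hT, i, rfl⟩, -⟩
    exact ⟨(T, i), by simp [hT], rfl⟩

/-- The facets carrying the skeleton terms (`𝓕_h^*`): all interior facets and the boundary facets
in `Γ₁`. -/
def activeFacets (𝒯 : Mesh Ω) (Γ₁ : Set (Pt d)) : Finset (Set (Pt d)) :=
  (𝒯.activeFacets_finite Γ₁).toFinset

open Classical in
/-- The elements adjacent to a facet `F`: two for an interior facet, one for a boundary facet. -/
def adjacent (𝒯 : Mesh Ω) (F : Set (Pt d)) : Finset 𝒯.elems :=
  Finset.univ.filter fun T => F ⊆ T.1.closedInterior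

/-- The mesh contains only elements `T` with `h_T ≤ σ ρ_T`, where `h_T` is the diameter of `T` and
`ρ_T` is the largest diameter of a ball contained in `T`. -/
def IsShapeRegular (𝒯 : Mesh Ω) (σ : ℝ) : Prop :=
  ∀ T ∈ 𝒯.elems, ∃ c : Pt d, ∃ r : ℝ,
    Metric.closedBall c r ⊆ T.closedInterior ∧ Metric.diam T.closedInterior ≤ σ * (2 * r)

end Mesh

/-- The unit normal on `F` that points out of the convex body `C`, for a `(d-1)`-dimensional
flat piece `F` of the boundary of `C`. -/
def outerNormal {d : ℕ} (C F : Set (Pt d)) : Pt d :=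
  Classical.epsilon fun n => ‖n‖ = 1 ∧ ∀ x ∈ F, ∀ y ∈ C, inner ℝ n (y - x) ≤ 0

/-! ### Discrete spaces

A discontinuous piecewise polynomial is given by its polynomial restrictions to the elements; these
restrictions also provide the one-sided traces on facets. -/

/-- The velocity space: piecewise polynomial vector fields of degree at most `k`. -/
abbrev Velocity {d : ℕ} {Ω : Set (Pt d)} (𝒯 : Mesh Ω) (k : ℕ) :=
  𝒯.elems → Fin d → MvPolynomial.restrictTotalDegree (Fin d) ℝ k

/-- The pressure space: piecewise polynomials of degree at most `k - 1`. -/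
abbrev Pressure {d : ℕ} {Ω : Set (Pt d)} (𝒯 : Mesh Ω) (k : ℕ) :=
  𝒯.elems → MvPolynomial.restrictTotalDegree (Fin d) ℝ (k - 1)

section Forms

variable {d : ℕ} {Ω : Set (Pt d)} {𝒯 : Mesh Ω} {k : ℕ}

/-- The value of `v|_T` at `x`. -/
def Velocity.val (v : Velocity 𝒯 k) (T : 𝒯.elems) (x : Pt d) : Fin d → ℝ :=
  fun i => MvPolynomial.eval (fun l => x l) (v T i).1

/-- The gradient of `v|_T` at `x`, with entries `∂_j v_i`. -/
def Velocity.grad (v : Velocity 𝒯 k) (T : 𝒯.elems) (x : Pt d) : Matrix (Fin d) (Fin d) ℝ :=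
  Matrix.of fun i j => MvPolynomial.eval (fun l => x l) (MvPolynomial.pderiv j (v T i).1)

/-- The divergence of `v|_T` at `x`. -/
def Velocity.div (v : Velocity 𝒯 k) (T : 𝒯.elems) (x : Pt d) : ℝ :=
  ∑ i, MvPolynomial.eval (fun l => x l) (MvPolynomial.pderiv i (v T i).1)

/-- The value of `q|_T` at `x`. -/
def Pressure.val (q : Pressure 𝒯 k) (T : 𝒯.elems) (x : Pt d) : ℝ :=
  MvPolynomial.eval (fun l => x l) (q T).1

/-- The tensor jump on `F`: the sum of `v_T ⊗ n_T` over the elements `T` adjacent to `F`. -/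
def Velocity.jump (v : Velocity 𝒯 k) (F : Set (Pt d)) (x : Pt d) : Matrix (Fin d) (Fin d) ℝ :=
  ∑ T ∈ 𝒯.adjacent F, Matrix.vecMulVec (v.val T x) (outerNormal T.1.closedInterior F)

/-- The scalar jump on `F`: the sum of `v_T · n_T` over the elements `T` adjacent to `F`. -/
def Velocity.scalarJump (v : Velocity 𝒯 k) (F : Set (Pt d)) (x : Pt d) : ℝ :=
  ∑ T ∈ 𝒯.adjacent F, v.val T x ⬝ᵥ (outerNormal T.1.closedInterior F).ofLp

/-- The average of `∇_h v` over the elements adjacent to `F`. -/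
def Velocity.meanGrad (v : Velocity 𝒯 k) (F : Set (Pt d)) (x : Pt d) :
    Matrix (Fin d) (Fin d) ℝ :=
  ((𝒯.adjacent F).card : ℝ)⁻¹ • ∑ T ∈ 𝒯.adjacent F, v.grad T x

/-- The average of `q` over the elements adjacent to `F`. -/
def Pressure.mean (q : Pressure 𝒯 k) (F : Set (Pt d)) (x : Pt d) : ℝ :=
  ((𝒯.adjacent F).card : ℝ)⁻¹ * ∑ T ∈ 𝒯.adjacent F, q.val T x

/-- The product `A : B` of matrices. -/
def frob (A B : Matrix (Fin d) (Fin d) ℝ) : ℝ := ∑ i, ∑ j, A i j * B i j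

/-- `∫_{𝓕_h^*} f`, for a family `f` of functions on the facets (with respect to surface measure). -/
def skeletonIntegral (𝒯 : Mesh Ω) (Γ₁ : Set (Pt d)) (f : Set (Pt d) → Pt d → ℝ) : ℝ :=
  ∑ F ∈ 𝒯.activeFacets Γ₁, ∫ x in F, f F x ∂μHE[d - 1]

/-- `∫_Ω f`, for a piecewise defined function `f`. -/
def brokenIntegral (𝒯 : Mesh Ω) (f : 𝒯.elems → Pt d → ℝ) : ℝ :=
  ∑ T : 𝒯.elems, ∫ x in T.1.closedInterior, f T x

/-- The form `a^𝕂(u, v) = ∫_Ω 𝕂⁻¹ u · v`. -/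
def aPerm (perm : Pt d → Matrix (Fin d) (Fin d) ℝ) (u v : Velocity 𝒯 k) : ℝ :=
  brokenIntegral 𝒯 fun T x => ((perm x)⁻¹ *ᵥ u.val T x) ⬝ᵥ v.val T x

/-- The interior penalty form `a_h^∇(u, v)`. -/
def aGrad (Γ₁ : Set (Pt d)) (ν aS ε : ℝ) (u v : Velocity 𝒯 k) : ℝ :=
  brokenIntegral 𝒯 (fun T x => ν * frob (u.grad T x) (v.grad T x))
    + skeletonIntegral 𝒯 Γ₁ (fun F x => aS / Metric.diam F * ν * frob (u.jump F x) (v.jump F x))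
    - skeletonIntegral 𝒯 Γ₁ (fun F x => frob (ν • u.meanGrad F x) (v.jump F x))
    - ε * skeletonIntegral 𝒯 Γ₁ (fun F x => frob (ν • v.meanGrad F x) (u.jump F x))

/-- The form `a_h = a^𝕂 + a_h^∇`. -/
def aForm (Γ₁ : Set (Pt d)) (perm : Pt d → Matrix (Fin d) (Fin d) ℝ) (ν aS ε : ℝ)
    (u v : Velocity 𝒯 k) : ℝ :=
  aPerm perm u v + aGrad Γ₁ ν aS ε u v

/-- The form `b_h(v, q) = -∫_Ω (div_h v) q + ∫_{𝓕_h^*} {q} [v]`. -/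
def bForm (Γ₁ : Set (Pt d)) (v : Velocity 𝒯 k) (q : Pressure 𝒯 k) : ℝ :=
  - brokenIntegral 𝒯 (fun T x => v.div T x * q.val T x)
    + skeletonIntegral 𝒯 Γ₁ (fun F x => q.mean F x * v.scalarJump F x)

/-- The square of the norm on the discrete velocities:
`‖v‖²_{0,Ω} + ‖∇_h v‖²_{0,Ω} + ‖h_𝓕^{-1/2} [v]‖²_{0,𝓕_h^*}`. -/
def normSq (Γ₁ : Set (Pt d)) (v : Velocity 𝒯 k) : ℝ :=
  brokenIntegral 𝒯 (fun T x => v.val T x ⬝ᵥ v.val T x)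
    + brokenIntegral 𝒯 (fun T x => frob (v.grad T x) (v.grad T x))
    + skeletonIntegral 𝒯 Γ₁ (fun F x => (Metric.diam F)⁻¹ * frob (v.jump F x) (v.jump F x))

end Forms

/-- The discrete kernel `𝓚_h` of `b_h`. -/
def discreteKernel {d : ℕ} {Ω : Set (Pt d)} (𝒯 : Mesh Ω) (k : ℕ) (Γ₁ : Set (Pt d)) :
    Set (Velocity 𝒯 k) :=
  {v | ∀ q : Pressure 𝒯 k, bForm Γ₁ v q = 0}

end

end BrinkmanDG

open BrinkmanDG

/-! For u = v the two consistency terms combine to (1 + ε) times one skeleton integral of {ν∇v}:[v].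
Young's inequality with weight δ·h_F on each facet F splits it into a jump part, absorbed by the
penalty once a_S is large, and a part with the averaged gradient. The latter is absorbed by the
broken gradient because of a discrete trace inequality, Σ_F h_F ‖{∇v}‖²_F ≤ C ‖∇_h v‖², where C
depends only on d, k and σ (`exists_mean_grad_bound`).

The trace inequality is proved without a reference element. The centre c of a ball of radius r in T
is joined to the points x of a face. On each segment a polynomial q of degree at most k satisfies
q(1)² ≤ C ∫ q² over [1/2, 1] (`exists_sq_eval_one_le_integral`). Integrating over the face gives an
integral over a truncated cone inside T, whose Jacobian is bounded below by the height of c times a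
power of 1/2, and the height is at least r (`exists_trace_constant`). Shape regularity then replaces
r by h_F. With hanging nodes the facets in one element need not be its faces, but three elements
share only a set of surface measure zero (`measure_inter_three_eq_zero`), which bounds the overlap
(`Mesh.sum_activeFacets_lintegral_le`).

The L² part comes from the permeability. Discrete velocities need not lie in H_{Γ₁}(Ω), so the
assumed lower bound cannot be applied to them; instead the entrywise bound M on 𝕂 gives 𝕂⁻¹ ≥ (dM)⁻¹
pointwise. Since the Bochner integral of a non-integrable function is 0, integrability of 𝕂⁻¹ on Ω
is also needed; it follows by testing the assumed bounds with smooth cutoffs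
(`IsPermeability.integrableOn_inv`). -/

namespace BrinkmanDG

/-! ### Polynomials in one variable -/

/-- The value of a polynomial of degree at most `k` at the endpoint `1` is a fixed linear
combination of its values at equidistant points to the left of `1`. -/
theorem exists_eval_one_eq_sum (k : ℕ) : ∃ a : ℕ → ℝ, ∀ q : Polynomial ℝ, q.natDegree ≤ k →
    ∀ s : ℝ, q.eval 1 = ∑ j ∈ Finset.range (k + 1), a j * q.eval (1 - (j + 1) * s) := by
  -- The (k+1)-st forward difference of t ↦ q(1 - s t) at 0 vanishes; it is solved for the term with
  -- shift 0.
  refine ⟨fun j => -((-1 : ℝ) ^ (k + 1) * (k + 1).choose 0)⁻¹ *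
    ((-1 : ℝ) ^ (k - j) * (k + 1).choose (j + 1)), fun q hq s => ?_⟩
  set P : Polynomial ℝ := q.comp (Polynomial.C 1 - Polynomial.C s * Polynomial.X) with hP
  have hdeg : P.natDegree < k + 1 := by
    have h1 : (Polynomial.C 1 - Polynomial.C s * Polynomial.X : Polynomial ℝ).natDegree ≤ 1 := by
      refine (Polynomial.natDegree_sub_le _ _).trans ?_
      rw [Polynomial.natDegree_C]
      exact max_le (Nat.zero_le _) ((Polynomial.natDegree_C_mul_le _ _).trans
        Polynomial.natDegree_X_le)
    have h2 := Polynomial.natDegree_comp_le (p := q)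
      (q := Polynomial.C 1 - Polynomial.C s * Polynomial.X)
    have h3 := Nat.mul_le_mul hq h1
    rw [← hP] at h2
    omega
  have h := congrFun (Polynomial.fwdDiff_iter_eq_zero_of_degree_lt hdeg) 0
  rw [fwdDiff_iter_eq_sum_shift, Finset.sum_range_succ'] at h
  have hev : ∀ t : ℝ, P.eval t = q.eval (1 - s * t) := by
    intro t; simp [hP, Polynomial.eval_comp]
  simp only [hev, zsmul_eq_mul, zero_add, nsmul_eq_mul, mul_one, Pi.zero_apply, Nat.cast_zero,
    mul_zero, sub_zero, Nat.cast_add, Nat.cast_one] at h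
  push_cast at h
  have hc : (-1 : ℝ) ^ (k + 1) * (k + 1).choose 0 ≠ 0 := by
    simp
  have h' : q.eval 1 = -((-1 : ℝ) ^ (k + 1) * (k + 1).choose 0)⁻¹ *
      ∑ j ∈ Finset.range (k + 1), (-1 : ℝ) ^ (k - j) * ((k + 1).choose (j + 1)) *
        q.eval (1 - s * (j + 1)) := by
    field_simp
    linarith
  rw [h', Finset.mul_sum]
  refine Finset.sum_congr rfl fun j _ => ?_
  rw [mul_comm s]
  ring

/-- Averaging the identity of `exists_eval_one_eq_sum` over the step s turns point values into
integrals; Cauchy–Schwarz handles the squares. -/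
theorem exists_sq_eval_one_le_integral (k : ℕ) : ∃ C : ℝ, 0 < C ∧ ∀ q : Polynomial ℝ,
    q.natDegree ≤ k → q.eval 1 ^ 2 ≤ C * ∫ t in (1 / 2 : ℝ)..1, q.eval t ^ 2 := by
  obtain ⟨a, ha⟩ := exists_eval_one_eq_sum k
  set A : ℝ := ∑ j ∈ Finset.range (k + 1), a j ^ 2 with hA
  have hA0 : 0 ≤ A := Finset.sum_nonneg fun j _ => sq_nonneg _
  -- The largest step for which all nodes 1 - (j+1)s with j ≤ k stay in [1/2, 1].
  set s₀ : ℝ := 1 / (2 * (k + 1)) with hs₀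
  have hs₀p : 0 < s₀ := by positivity
  refine ⟨s₀⁻¹ * (A + 1) * (k + 1), by positivity, fun q hq => ?_⟩
  have hcont : Continuous fun t : ℝ => q.eval t ^ 2 := by fun_prop
  have hint : ∀ u v : ℝ, IntervalIntegrable (fun t => q.eval t ^ 2) volume u v := fun u v =>
    hcont.intervalIntegrable u v
  set I := ∫ t in (1 / 2 : ℝ)..1, q.eval t ^ 2 with hI
  have hI0 : 0 ≤ I := intervalIntegral.integral_nonneg (by norm_num) fun t _ => sq_nonneg _
  have hpt : ∀ s : ℝ, q.eval 1 ^ 2 ≤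
      A * ∑ j ∈ Finset.range (k + 1), q.eval (1 - (j + 1) * s) ^ 2 := by
    intro s
    rw [ha q hq s]
    exact Finset.sum_mul_sq_le_sq_mul_sq _ _ _
  have hterm : ∀ j ∈ Finset.range (k + 1), ∫ s in (0 : ℝ)..s₀, q.eval (1 - (j + 1) * s) ^ 2 ≤ I := by
    intro j hj
    have hj1 : (j : ℝ) + 1 ≤ k + 1 := by
      have := Finset.mem_range.1 hj
      exact_mod_cast this
    have hjp : (0 : ℝ) < j + 1 := by positivity
    have hlow : (1 / 2 : ℝ) ≤ 1 - (j + 1) * s₀ := by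
      have : (j + 1 : ℝ) * s₀ ≤ (k + 1) * s₀ := mul_le_mul_of_nonneg_right hj1 hs₀p.le
      have h2 : ((k : ℝ) + 1) * s₀ = 1 / 2 := by rw [hs₀]; field_simp
      linarith
    rw [intervalIntegral.integral_comp_sub_mul (fun t => q.eval t ^ 2) hjp.ne' 1, mul_zero,
      sub_zero, smul_eq_mul]
    have hle : ∫ t in (1 - ((j : ℝ) + 1) * s₀)..1, q.eval t ^ 2 ≤ I :=
      intervalIntegral.integral_mono_interval hlow
        (by have := mul_pos hjp hs₀p; linarith) le_rfl
        (Filter.Eventually.of_forall fun t => sq_nonneg _) (hint _ _)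
    have hinv : ((j : ℝ) + 1)⁻¹ ≤ 1 := inv_le_one_of_one_le₀ (by linarith [Nat.cast_nonneg (α := ℝ) j])
    calc ((j : ℝ) + 1)⁻¹ * ∫ t in (1 - ((j : ℝ) + 1) * s₀)..1, q.eval t ^ 2
        ≤ ((j : ℝ) + 1)⁻¹ * I := mul_le_mul_of_nonneg_left hle (by positivity)
      _ ≤ 1 * I := mul_le_mul_of_nonneg_right hinv hI0
      _ = I := one_mul _
  have hmain : s₀ * q.eval 1 ^ 2 ≤ A * ((k + 1) * I) := by
    calc s₀ * q.eval 1 ^ 2 = ∫ s in (0 : ℝ)..s₀, q.eval 1 ^ 2 := by simp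
      _ ≤ ∫ s in (0 : ℝ)..s₀, A * ∑ j ∈ Finset.range (k + 1), q.eval (1 - (j + 1) * s) ^ 2 := by
          refine intervalIntegral.integral_mono_on hs₀p.le (by simp) ?_ fun s _ => hpt s
          exact (by fun_prop : Continuous fun s : ℝ =>
            A * ∑ j ∈ Finset.range (k + 1), q.eval (1 - (j + 1) * s) ^ 2).intervalIntegrable _ _
      _ = A * ∑ j ∈ Finset.range (k + 1), ∫ s in (0 : ℝ)..s₀, q.eval (1 - (j + 1) * s) ^ 2 := by
          rw [intervalIntegral.integral_const_mul, intervalIntegral.integral_finsetSum]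
          intro j _
          exact (by fun_prop : Continuous fun s : ℝ =>
            q.eval (1 - (j + 1) * s) ^ 2).intervalIntegrable _ _
      _ ≤ A * ∑ j ∈ Finset.range (k + 1), I :=
          mul_le_mul_of_nonneg_left (Finset.sum_le_sum hterm) hA0
      _ = A * ((k + 1) * I) := by simp
  have h3 : q.eval 1 ^ 2 ≤ s₀⁻¹ * (A * ((k + 1) * I)) := by
    rw [inv_mul_eq_div, le_div_iff₀ hs₀p, mul_comm]
    exact hmain
  refine h3.trans ?_
  have : 0 ≤ s₀⁻¹ * (((k : ℝ) + 1) * I) := by positivity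
  nlinarith

theorem exists_sq_eval_one_le_lintegral (k : ℕ) : ∃ C : ℝ, 0 < C ∧ ∀ q : Polynomial ℝ,
    q.natDegree ≤ k → ENNReal.ofReal (q.eval 1 ^ 2) ≤
      ENNReal.ofReal C * ∫⁻ t in Set.Icc (1 / 2 : ℝ) 1, ENNReal.ofReal (q.eval t ^ 2) := by
  obtain ⟨C, hC, h⟩ := exists_sq_eval_one_le_integral k
  refine ⟨C, hC, fun q hq => ?_⟩
  have hcont : Continuous fun t : ℝ => q.eval t ^ 2 := by fun_prop
  rw [← ofReal_integral_eq_lintegral_ofReal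
    (hcont.continuousOn.integrableOn_compact isCompact_Icc)
    (Filter.Eventually.of_forall fun t => sq_nonneg _), ← ENNReal.ofReal_mul hC.le]
  refine ENNReal.ofReal_le_ofReal ((h q hq).trans_eq ?_)
  rw [intervalIntegral.integral_of_le (by norm_num), integral_Icc_eq_integral_Ioc]

/-- Restricting a polynomial in several variables to a line. -/
theorem exists_polynomial_eval_line {d : ℕ} (p : MvPolynomial (Fin d) ℝ) {k : ℕ}
    (hp : p.totalDegree ≤ k) (c x : Pt d) : ∃ q : Polynomial ℝ, q.natDegree ≤ k ∧
      ∀ t : ℝ, q.eval t = MvPolynomial.eval (fun l => (c + t • (x - c)) l) p := by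
  refine ⟨MvPolynomial.aeval
    (fun l => Polynomial.C (c l) + Polynomial.X * Polynomial.C (x l - c l)) p, ?_, fun t => ?_⟩
  · rw [MvPolynomial.aeval_def, MvPolynomial.eval₂_eq]
    refine Polynomial.natDegree_sum_le_of_forall_le _ _ fun m hm => ?_
    refine (Polynomial.natDegree_C_mul_le _ _).trans ?_
    refine (Polynomial.natDegree_prod_le _ _).trans ?_
    refine le_trans (Finset.sum_le_sum (g := fun i => m i) fun i _ => ?_) ?_
    · refine Polynomial.natDegree_pow_le.trans ?_
      have : (Polynomial.C (c i) + Polynomial.X * Polynomial.C (x i - c i)).natDegree ≤ 1 := by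
        compute_degree
      simpa using Nat.mul_le_mul_left (m i) this
    · exact (MvPolynomial.le_totalDegree hm).trans hp
  · have h : (Polynomial.evalRingHom t).comp (MvPolynomial.aeval (R := ℝ)
        (fun l => Polynomial.C (c l) + Polynomial.X * Polynomial.C (x l - c l))).toRingHom =
        MvPolynomial.eval (fun l => (c + t • (x - c)) l) := by
      ext i <;> simp
    exact congrArg (fun f => f p) h

/-! ### Hyperplanes, cones and the surface measure -/

section Hyperplane

variable {d : ℕ} {n : Pt d}

theorem finrank_orthogonal_span {n : Pt d} (hn : ‖n‖ = 1) :
    Module.finrank ℝ (ℝ ∙ n)ᗮ = d - 1 := by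
  have h0 : n ≠ 0 := by rintro rfl; simp at hn
  have h := (ℝ ∙ n).finrank_add_finrank_orthogonal
  rw [finrank_span_singleton h0, finrank_euclideanSpace_fin] at h
  omega

/-- Coordinates along n and along its orthogonal complement preserve volume, which gives Fubini over
slices parallel to a facet. -/
theorem measurePreserving_orthogonal (hn : ‖n‖ = 1) (c : Pt d) :
    MeasurePreserving (fun z : ℝ × (ℝ ∙ n)ᗮ => c + z.1 • n + (z.2 : Pt d)) := by
  have h1 := ((ℝ ∙ n).measurePreserving_measurableEquivProd c).symm
  rw [InnerProductSpace.euclideanHausdorffMeasure_eq_volume] at h1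
  have h0 := (LinearIsometryEquiv.toSpanUnitSingleton n hn).measurePreserving
  have h2 := h0.prod (MeasurePreserving.id (volume : Measure (ℝ ∙ n)ᗮ))
  have h3 := h1.comp h2
  have h4 : (fun z : ℝ × (ℝ ∙ n)ᗮ => c + z.1 • n + (z.2 : Pt d)) =
      ((ℝ ∙ n).measurableEquivProd c).symm ∘
        Prod.map (LinearIsometryEquiv.toSpanUnitSingleton n hn) id := by
    funext z
    simp only [Function.comp, Prod.map, Submodule.measurableEquivProd_symm_apply, id,
      LinearIsometryEquiv.toSpanUnitSingleton_apply, vadd_eq_add]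
    abel
  rw [h4]
  exact h3

theorem lintegral_eq_lintegral_lintegral_orthogonal (hn : ‖n‖ = 1) (c : Pt d)
    {f : Pt d → ENNReal} (hf : Measurable f) :
    ∫⁻ y, f y = ∫⁻ τ : ℝ, ∫⁻ w : (ℝ ∙ n)ᗮ, f (c + τ • n + w) := by
  have h := measurePreserving_orthogonal hn c
  rw [← h.lintegral_comp hf, Measure.volume_eq_prod]
  exact lintegral_prod _ (hf.comp h.measurable).aemeasurable

theorem isometry_hyperplane (c : Pt d) : Isometry fun w : (ℝ ∙ n)ᗮ => c + (w : Pt d) :=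
  Isometry.of_dist_eq fun v w => by simp [Subtype.dist_eq]

theorem mem_range_hyperplane {c x : Pt d} (h : inner ℝ n (x - c) = 0) :
    x ∈ Set.range fun w : (ℝ ∙ n)ᗮ => c + (w : Pt d) :=
  ⟨⟨x - c, Submodule.mem_orthogonal_singleton_iff_inner_right.2 h⟩, by simp⟩

/-- An isometric inclusion preserves Hausdorff measure, and on the (d-1)-dimensional space n^⊥ this
measure is the volume. Surface integrals over flat pieces thus become volume integrals, to which
Haar scaling applies. -/
theorem map_hyperplane (hn : ‖n‖ = 1) (c : Pt d) :
    (volume : Measure (ℝ ∙ n)ᗮ).map (fun w : (ℝ ∙ n)ᗮ => c + (w : Pt d)) =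
      μHE[d - 1].restrict (Set.range fun w : (ℝ ∙ n)ᗮ => c + (w : Pt d)) := by
  rw [← (isometry_hyperplane c).map_euclideanHausdorffMeasure, ← finrank_orthogonal_span hn,
    InnerProductSpace.euclideanHausdorffMeasure_eq_volume]

theorem measurableEmbedding_hyperplane (c : Pt d) :
    MeasurableEmbedding fun w : (ℝ ∙ n)ᗮ => c + (w : Pt d) :=
  (isometry_hyperplane c).isClosedEmbedding.measurableEmbedding

theorem setLIntegral_hyperplane (hn : ‖n‖ = 1) {c : Pt d} {A : Set (Pt d)}
    (hA : MeasurableSet A) (hAc : ∀ x ∈ A, inner ℝ n (x - c) = 0) (f : Pt d → ENNReal) :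
    ∫⁻ x in A, f x ∂μHE[d - 1] =
      ∫⁻ w in (fun w : (ℝ ∙ n)ᗮ => c + (w : Pt d)) ⁻¹' A, f (c + w) := by
  have hsub : A ⊆ Set.range fun w : (ℝ ∙ n)ᗮ => c + (w : Pt d) := fun x hx =>
    mem_range_hyperplane (hAc x hx)
  rw [← (measurableEmbedding_hyperplane c).lintegral_map (μ := volume.restrict _) (f := f),
    ← (measurableEmbedding_hyperplane c).restrict_map, map_hyperplane hn, Measure.restrict_restrict hA,
    Set.inter_eq_self_of_subset_left hsub]

theorem measure_hyperplane (hn : ‖n‖ = 1) {c : Pt d} {A : Set (Pt d)}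
    (hA : MeasurableSet A) (hAc : ∀ x ∈ A, inner ℝ n (x - c) = 0) :
    μHE[d - 1] A = volume ((fun w : (ℝ ∙ n)ᗮ => c + (w : Pt d)) ⁻¹' A) := by
  simpa using setLIntegral_hyperplane hn hA hAc 1

theorem measure_hyperplane_lt_top (hn : ‖n‖ = 1) {s : ℝ} {A : Set (Pt d)}
    (hA : IsCompact A) (hAs : ∀ x ∈ A, inner ℝ n x = s) : μHE[d - 1] A < ⊤ := by
  rcases A.eq_empty_or_nonempty with rfl | ⟨c, hc⟩
  · simp
  rw [measure_hyperplane (c := c) hn hA.measurableSet fun x hx => by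
    rw [inner_sub_right, hAs x hx, hAs c hc, sub_self]]
  exact ((isometry_hyperplane c).isClosedEmbedding.isCompact_preimage hA).measure_lt_top

theorem lintegral_comp_smul {W : Type*} [NormedAddCommGroup W] [NormedSpace ℝ W]
    [MeasurableSpace W] [BorelSpace W] [FiniteDimensional ℝ W] (μ : Measure W)
    [μ.IsAddHaarMeasure] {r : ℝ} (hr : 0 < r) (f : W → ENNReal) :
    ENNReal.ofReal (r ^ Module.finrank ℝ W) * ∫⁻ w, f (r • w) ∂μ = ∫⁻ w, f w ∂μ := by
  have h := (Homeomorph.smulOfNeZero r hr.ne').measurableEmbedding.lintegral_map (μ := μ) f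
  have h2 := Measure.map_addHaar_smul μ hr.ne'
  have h3 : (⇑(Homeomorph.smulOfNeZero r hr.ne') : W → W) = (r • ·) := rfl
  have hp : 0 < r ^ Module.finrank ℝ W := pow_pos hr _
  rw [h3, h2, lintegral_smul_measure] at h
  rw [← h, smul_eq_mul, ← mul_assoc, abs_of_pos (inv_pos.2 hp), ← ENNReal.ofReal_mul hp.le,
    mul_inv_cancel₀ hp.ne', ENNReal.ofReal_one, one_mul]

/-- Integration over the part of a cone with tip `c` and base `A` close to the base. -/
theorem lintegral_cone_le (hn : ‖n‖ = 1) {c : Pt d} {h : ℝ} (hh : 0 < h) {A T : Set (Pt d)}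
    (hA : MeasurableSet A) (hAc : ∀ x ∈ A, inner ℝ n (x - c) = h) (hT : MeasurableSet T)
    (hAT : ∀ x ∈ A, ∀ t ∈ Set.Icc (1 / 2 : ℝ) 1, c + t • (x - c) ∈ T)
    {f : Pt d → ENNReal} (hf : Measurable f) :
    ENNReal.ofReal (h * (1 / 2) ^ (d - 1)) *
      ∫⁻ t in Set.Icc (1 / 2 : ℝ) 1, ∫⁻ x in A, f (c + t • (x - c)) ∂μHE[d - 1] ≤
      ∫⁻ y in T, f y := by
  have hnn : inner ℝ n n = (1 : ℝ) := by rw [real_inner_self_eq_norm_sq, hn, one_pow]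
  have hA' : ∀ x ∈ A, inner ℝ n (x - (c + h • n)) = 0 := by
    intro x hx
    rw [← sub_sub, inner_sub_right, hAc x hx, inner_smul_right, hnn, mul_one, sub_self]
  -- Slices at height τ = h·t above the tip: the substitution for τ contributes h. Below, scaling
  -- the slice by t contributes t^(d-1), which is at least (1/2)^(d-1).
  rw [← lintegral_indicator hT,
    lintegral_eq_lintegral_lintegral_orthogonal hn c (hf.indicator hT),
    ← lintegral_comp_smul volume hh, Module.finrank_self, pow_one, ENNReal.ofReal_mul hh.le, mul_assoc]
  refine mul_le_mul_right ?_ _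
  rw [← lintegral_const_mul' _ _ ENNReal.ofReal_ne_top]
  refine (setLIntegral_mono_ae' measurableSet_Icc (Filter.Eventually.of_forall fun t ht => ?_)).trans
    (setLIntegral_le_lintegral (Set.Icc (1 / 2 : ℝ) 1) _)
  have ht0 : 0 < t := lt_of_lt_of_le (by norm_num) ht.1
  rw [← lintegral_comp_smul volume ht0, finrank_orthogonal_span hn,
    setLIntegral_hyperplane hn hA hA']
  refine mul_le_mul' (ENNReal.ofReal_le_ofReal (pow_le_pow_left₀ (by norm_num) ht.1 _)) ?_
  refine (setLIntegral_mono_ae' ((measurableEmbedding_hyperplane _).measurable hA)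
    (Filter.Eventually.of_forall fun w hw => ?_)).trans (setLIntegral_le_lintegral _ _)
  have he : c + (t • h) • n + ((t • w : (ℝ ∙ n)ᗮ) : Pt d) =
      c + t • (c + h • n + (w : Pt d) - c) := by
    simp only [smul_eq_mul, Submodule.coe_smul]
    module
  have hmem : c + (h • t) • n + ((t • w : (ℝ ∙ n)ᗮ) : Pt d) ∈ T := by
    rw [smul_eq_mul, mul_comm h t, ← smul_eq_mul, he]
    exact hAT _ hw _ ht
  rw [Set.indicator_of_mem hmem, smul_eq_mul, mul_comm h t, ← smul_eq_mul, he]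

end Hyperplane

/-- The discrete trace inequality on a flat piece `A` of the boundary of a convex body `T`. -/
theorem exists_trace_constant (d k : ℕ) : ∃ C : ℝ, 0 < C ∧
    ∀ (p : MvPolynomial (Fin d) ℝ), p.totalDegree ≤ k → ∀ (n c : Pt d) (h r : ℝ) (A T : Set (Pt d)),
      ‖n‖ = 1 → 0 < r → r ≤ h → MeasurableSet A → (∀ x ∈ A, inner ℝ n (x - c) = h) →
      MeasurableSet T → (∀ x ∈ A, ∀ t ∈ Set.Icc (1 / 2 : ℝ) 1, c + t • (x - c) ∈ T) →
      μHE[d - 1] A < ⊤ →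
      ENNReal.ofReal r * ∫⁻ x in A, ENNReal.ofReal (MvPolynomial.eval (fun l => x l) p ^ 2) ∂μHE[d - 1] ≤
        ENNReal.ofReal C * ∫⁻ x in T, ENNReal.ofReal (MvPolynomial.eval (fun l => x l) p ^ 2) := by
  obtain ⟨C, hC, hpoly⟩ := exists_sq_eval_one_le_lintegral k
  -- The power of 2 compensates the Jacobian bound (1/2)^(d-1) of the truncated cone.
  refine ⟨C * 2 ^ (d - 1), by positivity, ?_⟩
  intro p hp n c h r A T hn hr hrh hA hAc hT hAT hfin
  have hcont : Continuous fun x : Pt d => ENNReal.ofReal (MvPolynomial.eval (fun l => x l) p ^ 2) :=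
    ENNReal.continuous_ofReal.comp
      (((MvPolynomial.continuous_eval p).comp (PiLp.continuous_ofLp 2 _)).pow 2)
  set f : Pt d → ENNReal := fun x => ENNReal.ofReal (MvPolynomial.eval (fun l => x l) p ^ 2)
    with hf
  have hline : ∀ x : Pt d, f x ≤
      ENNReal.ofReal C * ∫⁻ t in Set.Icc (1 / 2 : ℝ) 1, f (c + t • (x - c)) := by
    intro x
    obtain ⟨q, hq, hqe⟩ := exists_polynomial_eval_line p hp c x
    have h1 := hpoly q hq
    simp only [hqe] at h1
    simpa [hf] using h1
  have : IsFiniteMeasure (μHE[d - 1].restrict A) := ⟨by simpa using hfin⟩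
  have hswap : ∫⁻ x in A, (∫⁻ t in Set.Icc (1 / 2 : ℝ) 1, f (c + t • (x - c))) ∂μHE[d - 1] =
      ∫⁻ t in Set.Icc (1 / 2 : ℝ) 1, ∫⁻ x in A, f (c + t • (x - c)) ∂μHE[d - 1] := by
    refine lintegral_lintegral_swap (μ := μHE[d - 1].restrict A)
      (ν := volume.restrict (Set.Icc (1 / 2 : ℝ) 1)) ?_
    exact (hcont.comp (by fun_prop : Continuous fun z : Pt d × ℝ =>
      c + z.2 • (z.1 - c))).measurable.aemeasurable
  have hcone := lintegral_cone_le hn (hr.trans_le hrh) hA hAc hT hAT hcont.measurable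
  calc ENNReal.ofReal r * ∫⁻ x in A, f x ∂μHE[d - 1]
      ≤ ENNReal.ofReal h * (ENNReal.ofReal C *
          ∫⁻ t in Set.Icc (1 / 2 : ℝ) 1, ∫⁻ x in A, f (c + t • (x - c)) ∂μHE[d - 1]) := by
        refine mul_le_mul' (ENNReal.ofReal_le_ofReal hrh) ?_
        rw [← hswap, ← lintegral_const_mul' _ _ ENNReal.ofReal_ne_top]
        exact lintegral_mono (μ := μHE[d - 1].restrict A) fun x => hline x
    _ = ENNReal.ofReal (C * 2 ^ (d - 1)) * (ENNReal.ofReal (h * (1 / 2) ^ (d - 1)) *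
          ∫⁻ t in Set.Icc (1 / 2 : ℝ) 1, ∫⁻ x in A, f (c + t • (x - c)) ∂μHE[d - 1]) := by
        rw [← mul_assoc, ← mul_assoc, ← ENNReal.ofReal_mul (hr.le.trans hrh),
          ← ENNReal.ofReal_mul (by positivity)]
        congr 2
        have : (2 : ℝ) ^ (d - 1) * (1 / 2) ^ (d - 1) = 1 := by
          rw [← mul_pow]; norm_num
        linear_combination (-C * h) * this
    _ ≤ _ := mul_le_mul_right hcone _

/-! ### Convex bodies sharing a flat piece of their boundaries -/

section ConvexBodies

variable {d : ℕ}

theorem exists_separating_unit {T B : Set (Pt d)} (hT : Convex ℝ T) (hTi : (interior T).Nonempty)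
    (hB : Convex ℝ B) (hBn : B.Nonempty) (hdisj : Disjoint (interior T) B) :
    ∃ n : Pt d, ‖n‖ = 1 ∧ ∃ s : ℝ, (∀ y ∈ T, inner ℝ n y ≤ s) ∧ ∀ y ∈ B, s ≤ inner ℝ n y := by
  obtain ⟨f, u, hlt, hle⟩ := geometric_hahn_banach_open hT.interior isOpen_interior hB hdisj
  set m : Pt d := (InnerProductSpace.toDual ℝ (Pt d)).symm f with hm
  have hfm : ∀ y, f y = inner ℝ m y := fun y => by
    rw [hm, InnerProductSpace.toDual_symm_apply]
  obtain ⟨y₀, hy₀⟩ := hTi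
  obtain ⟨z₀, hz₀⟩ := hBn
  have hm0 : m ≠ 0 := by
    intro h0
    have h1 := (hlt y₀ hy₀).trans_le (hle z₀ hz₀)
    simp [hfm, h0] at h1
  have hmp : 0 < ‖m‖ := norm_pos_iff.2 hm0
  have hTle : ∀ y ∈ T, f y ≤ u := by
    intro y hy
    have hcl : y ∈ closure (interior T) := by
      rw [hT.closure_interior_eq_closure_of_nonempty_interior ⟨y₀, hy₀⟩]
      exact subset_closure hy
    exact closure_minimal (fun z hz => (hlt z hz).le) (isClosed_le f.continuous continuous_const) hcl
  refine ⟨‖m‖⁻¹ • m, norm_smul_inv_norm hm0, ‖m‖⁻¹ * u, fun y hy => ?_, fun y hy => ?_⟩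
  · rw [real_inner_smul_left, ← hfm]
    exact mul_le_mul_of_nonneg_left (hTle y hy) (inv_pos.2 hmp).le
  · rw [real_inner_smul_left, ← hfm]
    exact mul_le_mul_of_nonneg_left (hle y hy) (inv_pos.2 hmp).le

/-- Such a point shows on which side of a hyperplane a body lies when the body does not cross it. -/
theorem exists_mem_interior_inner_ne {T : Set (Pt d)} (hTi : (interior T).Nonempty) {n : Pt d}
    (hn : ‖n‖ = 1) (s : ℝ) : ∃ y ∈ interior T, inner ℝ n y ≠ s := by
  obtain ⟨y, hy⟩ := hTi
  have hnn : inner ℝ n n = (1 : ℝ) := by rw [real_inner_self_eq_norm_sq, hn, one_pow]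
  by_cases h : inner ℝ n y = s
  · have hcont : Filter.Tendsto (fun τ : ℝ => y + τ • n) (nhdsWithin 0 (Set.Ioi 0)) (nhds y) := by
      have : Continuous fun τ : ℝ => y + τ • n := by fun_prop
      simpa using (this.tendsto 0).mono_left nhdsWithin_le_nhds
    obtain ⟨τ, hτ, hτ0⟩ := ((hcont.eventually (isOpen_interior.mem_nhds hy)).and
      self_mem_nhdsWithin).exists
    refine ⟨_, hτ, ?_⟩
    rw [inner_add_right, inner_smul_right, hnn, h, mul_one]
    simpa using (Set.mem_Ioi.1 hτ0).ne'
  · exact ⟨y, hy, h⟩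

/-- A convex subset of a hyperplane with positive surface measure has a relative interior point. -/
theorem exists_relative_interior_point {n : Pt d} (hn : ‖n‖ = 1) {s : ℝ} {A : Set (Pt d)}
    (hA : Convex ℝ A) (hAm : MeasurableSet A) (hAs : ∀ x ∈ A, inner ℝ n x = s)
    (hpos : 0 < μHE[d - 1] A) :
    ∃ x ∈ A, ∀ v : Pt d, inner ℝ n v = 0 → ∀ᶠ t in nhds (0 : ℝ), x + t • v ∈ A := by
  obtain ⟨c, hc⟩ : A.Nonempty := by
    rw [Set.nonempty_iff_ne_empty]; rintro rfl; simp at hpos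
  set j : (ℝ ∙ n)ᗮ → Pt d := fun w => c + (w : Pt d) with hj
  have hconv : Convex ℝ (j ⁻¹' A) := by
    have h1 : j ⁻¹' A = (ℝ ∙ n)ᗮ.subtype ⁻¹' ((fun z => c + z) ⁻¹' A) := rfl
    rw [h1]
    exact (hA.translate_preimage_right c).linear_preimage _
  rw [measure_hyperplane (c := c) hn hAm fun x hx => by
    rw [inner_sub_right, hAs x hx, hAs c hc, sub_self]] at hpos
  -- A convex set with empty interior lies in its frontier, and the frontier of a convex set is a
  -- null set.
  have hint : (interior (j ⁻¹' A)).Nonempty := by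
    by_contra hempty
    rw [Set.not_nonempty_iff_eq_empty] at hempty
    have h0 := hconv.addHaar_frontier volume
    rw [frontier, hempty, Set.sdiff_empty] at h0
    exact hpos.ne' (measure_mono_null subset_closure h0)
  obtain ⟨w, hw⟩ := hint
  refine ⟨j w, interior_subset (s := j ⁻¹' A) hw, fun v hv => ?_⟩
  set v' : (ℝ ∙ n)ᗮ := ⟨v, Submodule.mem_orthogonal_singleton_iff_inner_right.2 hv⟩ with hv'
  have hcont : Continuous fun t : ℝ => w + t • v' := by fun_prop
  have htend : Filter.Tendsto (fun t : ℝ => w + t • v') (nhds 0) (nhds w) := by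
    simpa using hcont.tendsto 0
  filter_upwards [htend.eventually (isOpen_interior.mem_nhds hw)] with t ht
  have h2 : j (w + t • v') ∈ A := interior_subset (s := j ⁻¹' A) ht
  simpa [hj, hv', add_assoc] using h2

/-- With H the height of y over the hyperplane, x + τn is the convex combination, with weight τ/H on
y, of y and a point of A near x that compensates the tangential offset of y. -/
theorem eventually_mem_interior {n : Pt d} (hn : ‖n‖ = 1) {s : ℝ} {A T : Set (Pt d)}
    (hAT : A ⊆ T) (hT : Convex ℝ T) {x y : Pt d} (hxs : inner ℝ n x = s)
    (hx : ∀ v : Pt d, inner ℝ n v = 0 → ∀ᶠ t in nhds (0 : ℝ), x + t • v ∈ A)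
    (hy : y ∈ interior T) (hys : s < inner ℝ n y) :
    ∀ᶠ τ in nhdsWithin (0 : ℝ) (Set.Ioi 0), x + τ • n ∈ interior T := by
  set H : ℝ := inner ℝ n y - s with hH
  have hHp : 0 < H := sub_pos.2 hys
  have hnn : inner ℝ n n = (1 : ℝ) := by rw [real_inner_self_eq_norm_sq, hn, one_pow]
  have hv : inner ℝ n (x - y + H • n) = 0 := by
    rw [inner_add_right, inner_sub_right, inner_smul_right, hnn, hxs, hH]; ring
  have hca : ContinuousAt (fun τ : ℝ => (τ / H) / (1 - τ / H)) 0 := by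
    refine ContinuousAt.div (by fun_prop) (by fun_prop) (by simp)
  have htend : Filter.Tendsto (fun τ : ℝ => (τ / H) / (1 - τ / H)) (nhdsWithin 0 (Set.Ioi 0))
      (nhds 0) := by
    have h0 := hca.tendsto
    simp only [zero_div] at h0
    exact h0.mono_left nhdsWithin_le_nhds
  filter_upwards [htend.eventually (hx _ hv), self_mem_nhdsWithin,
    nhdsWithin_le_nhds (Iio_mem_nhds hHp)] with τ h1 h2 h3
  have hl0 : 0 < τ / H := div_pos h2 hHp
  have hl1 : τ / H < 1 := (div_lt_one hHp).2 h3
  have hmem := hT.combo_interior_self_mem_interior hy (hAT h1) hl0 (sub_pos.2 hl1).le (by ring)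
  convert hmem using 1
  have h4 : (1 - τ / H) * ((τ / H) / (1 - τ / H)) = τ / H :=
    mul_div_cancel₀ _ (sub_pos.2 hl1).ne'
  have h5 : (τ / H) * H = τ := div_mul_cancel₀ _ hHp.ne'
  rw [smul_add, smul_smul, h4, smul_add, smul_smul, h5]
  module

/-- Moving from a relative interior point of A slightly in the direction n enters both interiors. -/
theorem interior_inter_nonempty_of_same_side {n : Pt d} (hn : ‖n‖ = 1) {s : ℝ}
    {A T₁ T₂ : Set (Pt d)} (hA : Convex ℝ A) (hAm : MeasurableSet A)
    (hAs : ∀ x ∈ A, inner ℝ n x = s) (hpos : 0 < μHE[d - 1] A) (hA₁ : A ⊆ T₁) (hA₂ : A ⊆ T₂)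
    (hT₁ : Convex ℝ T₁) (hT₂ : Convex ℝ T₂) {y₁ y₂ : Pt d} (hy₁ : y₁ ∈ interior T₁)
    (hy₂ : y₂ ∈ interior T₂) (h₁ : s < inner ℝ n y₁) (h₂ : s < inner ℝ n y₂) :
    ¬ Disjoint (interior T₁) (interior T₂) := by
  obtain ⟨x, hxA, hx⟩ := exists_relative_interior_point hn hA hAm hAs hpos
  obtain ⟨τ, hτ₁, hτ₂⟩ := ((eventually_mem_interior hn hA₁ hT₁ (hAs x hxA) hx hy₁ h₁).and
    (eventually_mem_interior hn hA₂ hT₂ (hAs x hxA) hx hy₂ h₂)).exists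
  exact Set.not_disjoint_iff.2 ⟨_, hτ₁, hτ₂⟩

/-- Three convex bodies with pairwise disjoint interiors only share a set of surface measure zero. -/
theorem measure_inter_three_eq_zero {T₁ T₂ T₃ : Set (Pt d)} (hT₁ : Convex ℝ T₁) (hT₂ : Convex ℝ T₂)
    (hT₃ : Convex ℝ T₃) (hc₁ : IsClosed T₁) (hc₂ : IsClosed T₂) (hc₃ : IsClosed T₃)
    (hi₁ : (interior T₁).Nonempty) (hi₂ : (interior T₂).Nonempty) (hi₃ : (interior T₃).Nonempty)
    (h₁₂ : Disjoint (interior T₁) (interior T₂)) (h₁₃ : Disjoint (interior T₁) (interior T₃))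
    (h₂₃ : Disjoint (interior T₂) (interior T₃)) :
    μHE[d - 1] (T₁ ∩ T₂ ∩ T₃) = 0 := by
  by_contra hne
  have hpos : 0 < μHE[d - 1] (T₁ ∩ T₂ ∩ T₃) := pos_iff_ne_zero.2 hne
  have hA : Convex ℝ (T₁ ∩ T₂ ∩ T₃) := (hT₁.inter hT₂).inter hT₃
  have hAm : MeasurableSet (T₁ ∩ T₂ ∩ T₃) := ((hc₁.inter hc₂).inter hc₃).measurableSet
  obtain ⟨n, hn, s, hle₁, hle₂⟩ := exists_separating_unit hT₁ hi₁ hT₂.interior hi₂ h₁₂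
  have hle₂' : ∀ y ∈ T₂, s ≤ inner ℝ n y := by
    intro y hy
    have hcl : y ∈ closure (interior T₂) := by
      rw [hT₂.closure_interior_eq_closure_of_nonempty_interior hi₂]
      exact subset_closure hy
    exact closure_minimal hle₂ (isClosed_le continuous_const
      (by fun_prop : Continuous fun y : Pt d => inner ℝ n y)) hcl
  have hAs : ∀ x ∈ T₁ ∩ T₂ ∩ T₃, inner ℝ n x = s := fun x hx =>
    le_antisymm (hle₁ x hx.1.1) (hle₂' x hx.1.2)
  obtain ⟨y₁, hy₁, hs₁⟩ := exists_mem_interior_inner_ne hi₁ hn s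
  obtain ⟨y₂, hy₂, hs₂⟩ := exists_mem_interior_inner_ne hi₂ hn s
  obtain ⟨y₃, hy₃, hs₃⟩ := exists_mem_interior_inner_ne hi₃ hn s
  -- The hyperplane has T₁ and T₂ on opposite sides, so an interior point of T₃ off the hyperplane
  -- is on the same side as one of them.
  rcases lt_or_gt_of_ne hs₃ with h | h
  · refine interior_inter_nonempty_of_same_side (n := -n) (s := -s) (by rwa [norm_neg]) hA hAm
      (fun x hx => by rw [inner_neg_left, hAs x hx]) hpos (fun x hx => hx.1.1) (fun x hx => hx.2)
      hT₁ hT₃ hy₁ hy₃ ?_ ?_ h₁₃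
    · rw [inner_neg_left]
      exact neg_lt_neg (lt_of_le_of_ne (hle₁ _ (interior_subset hy₁)) hs₁)
    · rw [inner_neg_left]
      exact neg_lt_neg h
  · exact interior_inter_nonempty_of_same_side hn hA hAm hAs hpos (fun x hx => hx.1.2)
      (fun x hx => hx.2) hT₂ hT₃ hy₂ hy₃
      (lt_of_le_of_ne (hle₂' _ (interior_subset hy₂)) hs₂.symm) h h₂₃

end ConvexBodies

/-! ### Simplices -/

section Simplex

variable {d : ℕ}

theorem convex_closedInterior (T : Affine.Simplex ℝ (Pt d) d) : Convex ℝ T.closedInterior := by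
  rw [← T.convexHull_eq_closedInterior]
  exact convex_convexHull _ _

theorem affineSpan_range_points_eq_top (T : Affine.Simplex ℝ (Pt d) d) :
    affineSpan ℝ (Set.range T.points) = ⊤ := by
  rw [T.independent.affineSpan_eq_top_iff_card_eq_finrank_add_one]
  simp

theorem interior_closedInterior_nonempty (T : Affine.Simplex ℝ (Pt d) d) :
    (interior T.closedInterior).Nonempty := by
  rw [← T.convexHull_eq_closedInterior, interior_convexHull_nonempty_iff_affineSpan_eq_top]
  exact affineSpan_range_points_eq_top T

theorem simplexFacet_eq [NeZero d] (T : Affine.Simplex ℝ (Pt d) d) (i : Fin (d + 1)) :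
    simplexFacet T i = (T.faceOpposite i).closedInterior := by
  rw [simplexFacet, ← T.range_faceOpposite_points, Affine.Simplex.convexHull_eq_closedInterior]

/-- Links the topological interior, used for disjointness of elements, with the barycentric one,
used for faces. -/
theorem interior_closedInterior_eq [NeZero d] (T : Affine.Simplex ℝ (Pt d) d) :
    interior T.closedInterior = T.interior := by
  set b : AffineBasis (Fin (d + 1)) ℝ (Pt d) :=
    ⟨T.points, T.independent, affineSpan_range_points_eq_top T⟩ with hb
  have hbT : ⇑b = T.points := rfl
  rw [← T.convexHull_eq_closedInterior, ← hbT, b.interior_convexHull]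
  ext x
  have hx : Finset.univ.affineCombination ℝ T.points (fun i => b.coord i x) = x :=
    b.affineCombination_coord_eq_self x
  have hsum : ∑ i, b.coord i x = 1 := b.sum_coord_apply_eq_one x
  conv_rhs => rw [← hx]
  rw [Affine.Simplex.affineCombination_mem_interior_iff hsum]
  refine ⟨fun h i => ⟨h i, ?_⟩, fun h i => (h i).1⟩
  -- A second vertex exists because d ≠ 0; its positive weight forces the weight at i below 1.
  obtain ⟨j, hj⟩ : ∃ j : Fin (d + 1), j ≠ i := exists_ne i
  rw [← hsum]
  exact Finset.single_lt_sum hj (Finset.mem_univ i) (Finset.mem_univ j) (h j) fun l _ _ => (h l).le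

theorem simplexFacet_subset [NeZero d] (T : Affine.Simplex ℝ (Pt d) d) (i : Fin (d + 1)) :
    simplexFacet T i ⊆ T.closedInterior := by
  rw [simplexFacet_eq]
  exact T.closedInterior_faceOpposite_subset_closedInterior i

theorem disjoint_interior_simplexFacet [NeZero d] (T : Affine.Simplex ℝ (Pt d) d)
    (i : Fin (d + 1)) : Disjoint (interior T.closedInterior) (simplexFacet T i) := by
  rw [simplexFacet_eq, interior_closedInterior_eq]
  exact T.disjoint_interior_closedInterior_faceOpposite i

theorem convex_simplexFacet (T : Affine.Simplex ℝ (Pt d) d) (i : Fin (d + 1)) :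
    Convex ℝ (simplexFacet T i) := convex_convexHull _ _

theorem isCompact_simplexFacet (T : Affine.Simplex ℝ (Pt d) d) (i : Fin (d + 1)) :
    IsCompact (simplexFacet T i) :=
  ((Set.toFinite _).image _).isCompact_convexHull (𝕜 := ℝ)

theorem closedInterior_diff_interior_eq [NeZero d] (T : Affine.Simplex ℝ (Pt d) d) :
    T.closedInterior \ interior T.closedInterior = ⋃ i, simplexFacet T i := by
  simp only [simplexFacet_eq]
  rw [interior_closedInterior_eq, T.closedInterior_sdiff_interior]

/-- If the simplices `T`, `T'` have disjoint interiors, then `T ∩ T'` avoids the interior of `T`. -/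
theorem disjoint_interior_closedInterior {T T' : Affine.Simplex ℝ (Pt d) d}
    (h : Disjoint (interior T.closedInterior) (interior T'.closedInterior)) :
    Disjoint (interior T.closedInterior) T'.closedInterior := by
  have h1 := h.closure_right isOpen_interior
  rw [(convex_closedInterior T').closure_interior_eq_closure_of_nonempty_interior
    (interior_closedInterior_nonempty T'), T'.isClosed_closedInterior.closure_eq] at h1
  exact h1

/-- A convex part of a simplex outside of the interior lies in a supporting hyperplane. -/
theorem exists_supporting_unit (T : Affine.Simplex ℝ (Pt d) d) {A : Set (Pt d)}
    (hA : Convex ℝ A) (hAn : A.Nonempty) (hAT : A ⊆ T.closedInterior)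
    (hd : Disjoint (interior T.closedInterior) A) :
    ∃ n : Pt d, ‖n‖ = 1 ∧ ∃ s : ℝ, (∀ y ∈ T.closedInterior, inner ℝ n y ≤ s) ∧
      ∀ y ∈ A, inner ℝ n y = s := by
  obtain ⟨n, hn, s, h1, h2⟩ := exists_separating_unit (convex_closedInterior T)
    (interior_closedInterior_nonempty T) hA hAn hd
  exact ⟨n, hn, s, h1, fun y hy => le_antisymm (h1 y (hAT hy)) (h2 y hy)⟩

theorem measure_lt_top_of_disjoint_interior (T : Affine.Simplex ℝ (Pt d) d) {A : Set (Pt d)}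
    (hA : Convex ℝ A) (hAc : IsCompact A) (hAT : A ⊆ T.closedInterior)
    (hd : Disjoint (interior T.closedInterior) A) : μHE[d - 1] A < ⊤ := by
  rcases A.eq_empty_or_nonempty with rfl | hne
  · simp
  obtain ⟨n, hn, s, -, h2⟩ := exists_supporting_unit T hA hne hAT hd
  exact measure_hyperplane_lt_top hn hAc h2

/-- The tip of the cone is the centre of the ball. The point c + r n still lies behind the
supporting hyperplane of the face, so the height of the cone is at least r. -/
theorem exists_simplexFacet_trace_constant (d k : ℕ) [NeZero d] : ∃ C : ℝ, 0 < C ∧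
    ∀ (p : MvPolynomial (Fin d) ℝ), p.totalDegree ≤ k → ∀ (T : Affine.Simplex ℝ (Pt d) d)
      (i : Fin (d + 1)) (c : Pt d) (r : ℝ), 0 < r → Metric.closedBall c r ⊆ T.closedInterior →
      ENNReal.ofReal r *
        ∫⁻ x in simplexFacet T i, ENNReal.ofReal (MvPolynomial.eval (fun l => x l) p ^ 2) ∂μHE[d - 1] ≤
      ENNReal.ofReal C *
        ∫⁻ x in T.closedInterior, ENNReal.ofReal (MvPolynomial.eval (fun l => x l) p ^ 2) := by
  obtain ⟨C, hC, htr⟩ := exists_trace_constant d k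
  refine ⟨C, hC, fun p hp T i c r hr hball => ?_⟩
  rcases (simplexFacet T i).eq_empty_or_nonempty with he | hne
  · simp [he]
  obtain ⟨n, hn, s, h1, h2⟩ := exists_supporting_unit T (convex_simplexFacet T i) hne
    (simplexFacet_subset T i) (disjoint_interior_simplexFacet T i)
  have hnn : inner ℝ n n = (1 : ℝ) := by rw [real_inner_self_eq_norm_sq, hn, one_pow]
  have hcT : c ∈ T.closedInterior := hball (Metric.mem_closedBall_self hr.le)
  have hrs : r ≤ s - inner ℝ n c := by
    have hmem : c + r • n ∈ Metric.closedBall c r := by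
      simp [norm_smul, hn, abs_of_pos hr]
    have := h1 _ (hball hmem)
    rw [inner_add_right, inner_smul_right, hnn] at this
    linarith
  refine htr p hp n c (s - inner ℝ n c) r _ _ hn hr hrs (isCompact_simplexFacet T i).measurableSet
    (fun x hx => by rw [inner_sub_right, h2 x hx]) T.isClosed_closedInterior.measurableSet
    (fun x hx t ht => ?_) (measure_lt_top_of_disjoint_interior T (convex_simplexFacet T i)
      (isCompact_simplexFacet T i) (simplexFacet_subset T i) (disjoint_interior_simplexFacet T i))
  exact (convex_closedInterior T).add_smul_sub_mem hcT (simplexFacet_subset T i hx)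
    ⟨by linarith [ht.1], ht.2⟩

end Simplex

/-! ### The facets on the boundary of one element -/

theorem sum_le_sum_of_cover {α β : Type*} (S : Finset α) (R : Finset β) (U : β → Finset α)
    (hS : ∀ a ∈ S, ∃ b ∈ R, a ∈ U b) (f : α → ENNReal) :
    ∑ a ∈ S, f a ≤ ∑ b ∈ R, ∑ a ∈ U b, f a := by
  classical
  calc ∑ a ∈ S, f a ≤ ∑ a ∈ S, ∑ b ∈ R, if a ∈ U b then f a else 0 := by
        refine Finset.sum_le_sum fun a ha => ?_
        obtain ⟨b, hb, hab⟩ := hS a ha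
        calc f a = if a ∈ U b then f a else 0 := by rw [if_pos hab]
          _ ≤ _ := Finset.single_le_sum (f := fun b => if a ∈ U b then f a else 0)
            (fun _ _ => zero_le) hb
    _ = ∑ b ∈ R, ∑ a ∈ S, if a ∈ U b then f a else 0 := Finset.sum_comm
    _ ≤ ∑ b ∈ R, ∑ a ∈ U b, f a := by
        refine Finset.sum_le_sum fun b _ => ?_
        rw [← Finset.sum_filter]
        exact Finset.sum_le_sum_of_subset fun a ha => (Finset.mem_filter.1 ha).2

namespace Mesh

variable {d : ℕ} {Ω : Set (Pt d)} (𝒯 : Mesh Ω)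

theorem lintegral_iUnion_simplexFacet_le (T : Affine.Simplex ℝ (Pt d) d) (g : Pt d → ENNReal) :
    ∫⁻ x in ⋃ i, simplexFacet T i, g x ∂μHE[d - 1] ≤
      ∑ i, ∫⁻ x in simplexFacet T i, g x ∂μHE[d - 1] :=
  (lintegral_iUnion_le _ _).trans_eq (tsum_fintype _)

-- The sets T ∩ T' overlap only in null sets, by the result on three bodies, and all lie in the
-- boundary of T; hence their integrals add up to at most the integral over that boundary.
open Classical in
theorem sum_lintegral_inter_le [NeZero d] {T : Affine.Simplex ℝ (Pt d) d} (hT : T ∈ 𝒯.elems)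
    (g : Pt d → ENNReal) :
    ∑ T' ∈ 𝒯.elems.erase T, ∫⁻ x in T.closedInterior ∩ T'.closedInterior, g x ∂μHE[d - 1] ≤
      ∑ i, ∫⁻ x in simplexFacet T i, g x ∂μHE[d - 1] := by
  rw [← lintegral_biUnion_finset₀]
  · refine (lintegral_mono_set ?_).trans (lintegral_iUnion_simplexFacet_le T g)
    rw [← closedInterior_diff_interior_eq]
    refine Set.iUnion₂_subset fun T' hT' x hx => ⟨hx.1, fun hxi => ?_⟩
    have hT'm := Finset.mem_erase.1 hT'
    exact (Set.disjoint_left.1 (disjoint_interior_closedInterior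
      (𝒯.disjoint_interior T hT T' hT'm.2 hT'm.1.symm)) hxi) hx.2
  · intro T₁ h₁ T₂ h₂ hne
    have h₁' := Finset.mem_erase.1 (Finset.mem_coe.1 h₁)
    have h₂' := Finset.mem_erase.1 (Finset.mem_coe.1 h₂)
    refine measure_mono_null ?_ (measure_inter_three_eq_zero (convex_closedInterior T)
      (convex_closedInterior T₁) (convex_closedInterior T₂) T.isClosed_closedInterior
      T₁.isClosed_closedInterior T₂.isClosed_closedInterior (interior_closedInterior_nonempty T)
      (interior_closedInterior_nonempty T₁) (interior_closedInterior_nonempty T₂)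
      (𝒯.disjoint_interior T hT T₁ h₁'.2 h₁'.1.symm) (𝒯.disjoint_interior T hT T₂ h₂'.2 h₂'.1.symm)
      (𝒯.disjoint_interior T₁ h₁'.2 T₂ h₂'.2 hne))
    exact fun x hx => ⟨hx.1, hx.2.2⟩
  · intro T' _
    exact (T.isClosed_closedInterior.inter T'.isClosed_closedInterior).measurableSet.nullMeasurableSet

/-- An interior facet contained in the element `T` is the intersection of `T` with another one. -/
theorem exists_eq_inter_of_mem_interiorFacets {T : Affine.Simplex ℝ (Pt d) d} (hT : T ∈ 𝒯.elems)
    {F : Set (Pt d)} (hF : F ∈ 𝒯.interiorFacets) (hFT : F ⊆ T.closedInterior) :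
    ∃ T' ∈ 𝒯.elems, T' ≠ T ∧ F = T.closedInterior ∩ T'.closedInterior := by
  obtain ⟨hpos, T₁, h₁, T₂, h₂, hne, rfl⟩ := hF
  by_cases e₁ : T₁ = T
  · subst e₁
    exact ⟨T₂, h₂, hne.symm, rfl⟩
  by_cases e₂ : T₂ = T
  · subst e₂
    exact ⟨T₁, h₁, hne, Set.inter_comm _ _⟩
  · have h0 := measure_inter_three_eq_zero (convex_closedInterior T₁) (convex_closedInterior T₂)
      (convex_closedInterior T) T₁.isClosed_closedInterior T₂.isClosed_closedInterior
      T.isClosed_closedInterior (interior_closedInterior_nonempty T₁)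
      (interior_closedInterior_nonempty T₂) (interior_closedInterior_nonempty T)
      (𝒯.disjoint_interior T₁ h₁ T₂ h₂ hne) (𝒯.disjoint_interior T₁ h₁ T hT e₁)
      (𝒯.disjoint_interior T₂ h₂ T hT e₂)
    rw [Set.inter_eq_self_of_subset_left hFT] at h0
    exact absurd h0 hpos.ne'

theorem mem_activeFacets {Γ₁ F : Set (Pt d)} :
    F ∈ 𝒯.activeFacets Γ₁ ↔ F ∈ 𝒯.interiorFacets ∨ F ∈ 𝒯.boundaryFacetsIn Γ₁ := by
  rw [activeFacets, Set.Finite.mem_toFinset, Set.mem_union]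

-- Each active facet in T is assigned to some element T'. For T' = T it is a face of T. For T' ≠ T
-- it is T ∩ T' or a face of T', so there are at most d + 2 candidates, all inside T ∩ T'. The
-- factor is (d + 2) + 1.
open Classical in
theorem sum_activeFacets_lintegral_le [NeZero d] (Γ₁ : Set (Pt d))
    {T : Affine.Simplex ℝ (Pt d) d} (hT : T ∈ 𝒯.elems) (g : Pt d → ENNReal) :
    ∑ F ∈ (𝒯.activeFacets Γ₁).filter (· ⊆ T.closedInterior), ∫⁻ x in F, g x ∂μHE[d - 1] ≤
      (d + 3 : ℕ) * ∑ i, ∫⁻ x in simplexFacet T i, g x ∂μHE[d - 1] := by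
  set U : Affine.Simplex ℝ (Pt d) d → Finset (Set (Pt d)) := fun T' =>
    if T' = T then Finset.univ.image (simplexFacet T) else
      (insert (T.closedInterior ∩ T'.closedInterior) (Finset.univ.image (simplexFacet T'))).filter
        (· ⊆ T.closedInterior ∩ T'.closedInterior) with hU
  set B := ∑ i, ∫⁻ x in simplexFacet T i, g x ∂μHE[d - 1] with hB
  refine (sum_le_sum_of_cover _ 𝒯.elems U (fun F hF => ?_) _).trans ?_
  · obtain ⟨hF, hFT⟩ := Finset.mem_filter.1 hF
    rcases 𝒯.mem_activeFacets.1 hF with hF | ⟨⟨-, T', hT', i, rfl⟩, -⟩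
    · obtain ⟨T', hT', hne, rfl⟩ := 𝒯.exists_eq_inter_of_mem_interiorFacets hT hF hFT
      exact ⟨T', hT', by simp [hU, hne]⟩
    · refine ⟨T', hT', ?_⟩
      by_cases hne : T' = T
      · subst hne
        simp [hU]
      · simp only [hU, if_neg hne]
        exact Finset.mem_filter.2 ⟨Finset.mem_insert_of_mem
          (Finset.mem_image_of_mem _ (Finset.mem_univ i)),
          Set.subset_inter hFT (simplexFacet_subset T' i)⟩
  · rw [← Finset.add_sum_erase _ _ hT]
    have h1 : ∑ F ∈ U T, ∫⁻ x in F, g x ∂μHE[d - 1] ≤ B := by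
      simp only [hU, if_true]
      refine (sum_le_sum_of_cover _ Finset.univ (fun i => {simplexFacet T i}) (fun F hF => ?_)
        _).trans_eq (by simp [hB])
      obtain ⟨i, hi, rfl⟩ := Finset.mem_image.1 hF
      exact ⟨i, hi, Finset.mem_singleton_self _⟩
    have h2 : ∀ T' ∈ 𝒯.elems.erase T, ∑ F ∈ U T', ∫⁻ x in F, g x ∂μHE[d - 1] ≤
        (d + 2 : ℕ) * ∫⁻ x in T.closedInterior ∩ T'.closedInterior, g x ∂μHE[d - 1] := by
      intro T' hT'
      have hcard : (U T').card ≤ d + 2 := by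
        simp only [hU, if_neg (Finset.mem_erase.1 hT').1]
        refine (Finset.card_filter_le _ _).trans ((Finset.card_insert_le _ _).trans ?_)
        have := Finset.card_image_le (s := (Finset.univ : Finset (Fin (d + 1))))
          (f := simplexFacet T')
        rw [Finset.card_univ, Fintype.card_fin] at this
        omega
      calc ∑ F ∈ U T', ∫⁻ x in F, g x ∂μHE[d - 1]
          ≤ (U T').card • ∫⁻ x in T.closedInterior ∩ T'.closedInterior, g x ∂μHE[d - 1] := by
            refine Finset.sum_le_card_nsmul _ _ _ fun F hF => lintegral_mono_set ?_
            simp only [hU, if_neg (Finset.mem_erase.1 hT').1] at hF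
            exact (Finset.mem_filter.1 hF).2
        _ ≤ _ := by
            rw [nsmul_eq_mul]
            exact mul_le_mul_left (by exact_mod_cast hcard) _
    calc _ ≤ B + ∑ T' ∈ 𝒯.elems.erase T,
          (d + 2 : ℕ) * ∫⁻ x in T.closedInterior ∩ T'.closedInterior, g x ∂μHE[d - 1] :=
          add_le_add h1 (Finset.sum_le_sum h2)
      _ ≤ B + (d + 2 : ℕ) * B := by
          rw [← Finset.mul_sum]
          gcongr
          exact 𝒯.sum_lintegral_inter_le hT g
      _ = (d + 3 : ℕ) * B := by push_cast; ring

end Mesh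

open Classical in
/-- The discrete trace inequality, summed over all facets on the boundary of one element. -/
theorem exists_element_trace_constant (d k : ℕ) [NeZero d] (σ : ℝ) (hσ : 0 < σ) :
    ∃ C : ℝ, 0 < C ∧ ∀ (Ω Γ₁ : Set (Pt d)) (𝒯 : Mesh Ω), 𝒯.IsShapeRegular σ → ∀ T ∈ 𝒯.elems,
      ∀ p : MvPolynomial (Fin d) ℝ, p.totalDegree ≤ k →
      ∑ F ∈ (𝒯.activeFacets Γ₁).filter (· ⊆ T.closedInterior), ENNReal.ofReal (Metric.diam F) *
        ∫⁻ x in F, ENNReal.ofReal (MvPolynomial.eval (fun l => x l) p ^ 2) ∂μHE[d - 1] ≤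
      ENNReal.ofReal C *
        ∫⁻ x in T.closedInterior, ENNReal.ofReal (MvPolynomial.eval (fun l => x l) p ^ 2) := by
  obtain ⟨C, hC, htr⟩ := exists_simplexFacet_trace_constant d k
  -- 2σ comes from diam F ≤ h_T ≤ 2σr, d + 3 from the overlap of facets, d + 1 from the number of
  -- faces.
  refine ⟨2 * σ * (d + 3) * ((d + 1) * C), by positivity, fun Ω Γ₁ 𝒯 hreg T hT p hp => ?_⟩
  set g : Pt d → ENNReal := fun x => ENNReal.ofReal (MvPolynomial.eval (fun l => x l) p ^ 2)
  obtain ⟨c, r, hball, hdiam⟩ := hreg T hT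
  have hdF : ∀ F ∈ (𝒯.activeFacets Γ₁).filter (· ⊆ T.closedInterior),
      Metric.diam F ≤ 2 * σ * r := fun F hF => by
    have := Metric.diam_mono (Finset.mem_filter.1 hF).2 T.isCompact_closedInterior.isBounded
    linarith
  calc _ ≤ ∑ F ∈ (𝒯.activeFacets Γ₁).filter (· ⊆ T.closedInterior), ENNReal.ofReal (2 * σ * r) *
        ∫⁻ x in F, g x ∂μHE[d - 1] := by
        refine Finset.sum_le_sum fun F hF => ?_
        gcongr
        exact hdF F hF
    _ ≤ ENNReal.ofReal (2 * σ * r) *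
          ((d + 3 : ℕ) * ∑ i, ∫⁻ x in simplexFacet T i, g x ∂μHE[d - 1]) := by
        rw [← Finset.mul_sum]
        gcongr
        exact 𝒯.sum_activeFacets_lintegral_le Γ₁ hT g
    _ = ENNReal.ofReal (2 * σ * (d + 3)) *
          ∑ i, ENNReal.ofReal r * ∫⁻ x in simplexFacet T i, g x ∂μHE[d - 1] := by
        rw [ENNReal.ofReal_mul (by positivity), ENNReal.ofReal_mul (q := (d : ℝ) + 3) (by positivity),
          ← Finset.mul_sum]
        have : ENNReal.ofReal ((d : ℝ) + 3) = ((d + 3 : ℕ) : ENNReal) := by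
          rw [← ENNReal.ofReal_natCast]; push_cast; rfl
        rw [this]
        ring
    _ ≤ ENNReal.ofReal (2 * σ * (d + 3)) *
          ∑ _i : Fin (d + 1), ENNReal.ofReal C * ∫⁻ x in T.closedInterior, g x := by
        refine mul_le_mul_right (Finset.sum_le_sum fun i _ => ?_) _
        -- `Mesh.IsShapeRegular` does not demand r > 0; otherwise the left-hand side vanishes.
        rcases le_or_gt r 0 with hr | hr
        · simp [ENNReal.ofReal_of_nonpos hr]
        · exact htr p hp T i c r hr hball
    _ = _ := by
        rw [Finset.sum_const, Finset.card_univ, Fintype.card_fin, nsmul_eq_mul,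
          ENNReal.ofReal_mul (by positivity : (0 : ℝ) ≤ 2 * σ * (d + 3)),
          ENNReal.ofReal_mul (p := (d : ℝ) + 1) (by positivity)]
        have : ENNReal.ofReal ((d : ℝ) + 1) = ((d + 1 : ℕ) : ENNReal) := by
          rw [← ENNReal.ofReal_natCast]; push_cast; rfl
        rw [this]
        ring

/-! ### The permeability term -/

section Matrices

variable {d : ℕ}

theorem isSymm_of_posDef {A : Matrix (Fin d) (Fin d) ℝ} (hA : A.PosDef) : Aᵀ = A := by
  have h := hA.isHermitian.eq
  rwa [conjTranspose_eq_transpose_of_trivial] at h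

theorem dotProduct_mulVec_nonneg_of_posDef {A : Matrix (Fin d) (Fin d) ℝ} (hA : A.PosDef)
    (x : Fin d → ℝ) : 0 ≤ x ⬝ᵥ (A *ᵥ x) := by
  simpa using hA.posSemidef.dotProduct_mulVec_nonneg x

theorem dotProduct_mulVec_comm_of_posDef {A : Matrix (Fin d) (Fin d) ℝ} (hA : A.PosDef)
    (x y : Fin d → ℝ) : x ⬝ᵥ (A *ᵥ y) = y ⬝ᵥ (A *ᵥ x) := by
  rw [dotProduct_mulVec, ← mulVec_transpose, isSymm_of_posDef hA, dotProduct_comm]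

theorem dotProduct_mulVec_le_of_abs_le {A : Matrix (Fin d) (Fin d) ℝ} {M : ℝ}
    (hM : ∀ i j, |A i j| ≤ M) (x : Fin d → ℝ) : x ⬝ᵥ (A *ᵥ x) ≤ d * M * (x ⬝ᵥ x) := by
  have h : ∀ i j, x i * (A i j * x j) ≤ M / 2 * (x i ^ 2 + x j ^ 2) := by
    intro i j
    have h1 : x i * (A i j * x j) ≤ |A i j| * (|x i| * |x j|) := by
      refine (le_abs_self _).trans_eq ?_
      rw [abs_mul, abs_mul]; ring
    have h2 : |x i| * |x j| ≤ (x i ^ 2 + x j ^ 2) / 2 := by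
      rw [← sq_abs (x i), ← sq_abs (x j)]
      nlinarith [sq_nonneg (|x i| - |x j|)]
    have h3 : |A i j| * (|x i| * |x j|) ≤ M * ((x i ^ 2 + x j ^ 2) / 2) :=
      mul_le_mul (hM i j) h2 (by positivity) ((abs_nonneg _).trans (hM i j))
    linarith
  calc x ⬝ᵥ (A *ᵥ x) = ∑ i, ∑ j, x i * (A i j * x j) := by
        simp only [dotProduct, mulVec, Finset.mul_sum]
    _ ≤ ∑ i, ∑ j, M / 2 * (x i ^ 2 + x j ^ 2) :=
        Finset.sum_le_sum fun i _ => Finset.sum_le_sum fun j _ => h i j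
    _ = d * M * (x ⬝ᵥ x) := by
        simp only [mul_add, Finset.sum_add_distrib, Finset.sum_const, Finset.card_univ,
          Fintype.card_fin, nsmul_eq_mul, ← Finset.mul_sum, dotProduct, ← sq]
        ring

/-- The inverse of a bounded positive definite matrix is bounded below. -/
theorem dotProduct_self_le_of_posDef {A : Matrix (Fin d) (Fin d) ℝ} (hA : A.PosDef) {M : ℝ}
    (hM : ∀ i j, |A i j| ≤ M) (hdM : 0 < d * M) (x : Fin d → ℝ) :
    x ⬝ᵥ x ≤ d * M * ((A⁻¹ *ᵥ x) ⬝ᵥ x) := by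
  set K : ℝ := d * M with hK
  set y := A⁻¹ *ᵥ x with hy
  have hAy : A *ᵥ y = x := by
    rw [hy, mulVec_mulVec, mul_nonsing_inv _ ((isUnit_iff_isUnit_det A).1 hA.isUnit), one_mulVec]
  -- Expanding the form of A at x - K A⁻¹x and using xᵀAx ≤ K|x|² leaves K|x|² ≤ K² (A⁻¹x · x).
  have h0 := dotProduct_mulVec_nonneg_of_posDef hA (x - K • y)
  have h1 : (x - K • y) ⬝ᵥ (A *ᵥ (x - K • y)) =
      x ⬝ᵥ (A *ᵥ x) - 2 * K * (x ⬝ᵥ x) + K ^ 2 * (y ⬝ᵥ x) := by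
    simp only [mulVec_sub, mulVec_smul, dotProduct_sub, sub_dotProduct, smul_dotProduct,
      dotProduct_smul, hAy, dotProduct_mulVec_comm_of_posDef hA y x, smul_eq_mul]
    ring
  have h2 := dotProduct_mulVec_le_of_abs_le hM x
  rw [← hK] at h2
  rw [h1] at h0
  have h3 : K * (x ⬝ᵥ x) ≤ K * (K * (y ⬝ᵥ x)) := by nlinarith
  exact le_of_mul_le_mul_left h3 hdM

/-- Positivity at e_i ± e_j. It reduces integrability of 𝕂⁻¹ to its diagonal entries. -/
theorem abs_apply_le_of_posDef {A : Matrix (Fin d) (Fin d) ℝ} (hA : A.PosDef) (i j : Fin d) :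
    |A i j| ≤ A i i + A j j := by
  have h1 := dotProduct_mulVec_nonneg_of_posDef hA (Pi.single i 1 + Pi.single j 1)
  have h2 := dotProduct_mulVec_nonneg_of_posDef hA (Pi.single i 1 - Pi.single j 1)
  have hs : A j i = A i j := by
    conv_rhs => rw [← isSymm_of_posDef hA]
    rfl
  have hi : 0 ≤ A i i := hA.posSemidef.diag_nonneg
  have hj : 0 ≤ A j j := hA.posSemidef.diag_nonneg
  simp only [mulVec_add, mulVec_sub, mulVec_single_one, dotProduct_add, add_dotProduct,
    sub_dotProduct, dotProduct_sub, single_dotProduct, col_apply, one_mul] at h1 h2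
  rw [abs_le]
  constructor <;> linarith

theorem measurable_inv_apply (i j : Fin d) :
    Measurable fun M : Fin d → Fin d → ℝ => ((Matrix.of M)⁻¹ : Matrix (Fin d) (Fin d) ℝ) i j := by
  have h : (fun M : Fin d → Fin d → ℝ => ((Matrix.of M)⁻¹ : Matrix (Fin d) (Fin d) ℝ) i j) =
      fun M => (Matrix.of M).det⁻¹ * (Matrix.of M).adjugate i j := by
    funext M
    rw [inv_def, Matrix.smul_apply, Ring.inverse_eq_inv', smul_eq_mul]
  rw [h]
  have hid : Continuous fun M : Fin d → Fin d → ℝ => (Matrix.of M : Matrix (Fin d) (Fin d) ℝ) :=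
    continuous_id
  exact hid.matrix_det.measurable.inv.mul
    ((hid.matrix_adjugate.matrix_elem i j).measurable)

end Matrices

/-! ### Smooth test fields supported in the domain -/

section Cutoff

variable {d : ℕ} {Ω Γ₁ : Set (Pt d)}

theorem exists_smooth_cutoff {K : Set (Pt d)} (hK : IsCompact K) (hΩ : IsOpen Ω) (hKΩ : K ⊆ Ω) :
    ∃ φ : Pt d → ℝ, ContDiff ℝ ∞ φ ∧ HasCompactSupport φ ∧ tsupport φ ⊆ Ω ∧
      (∀ x, φ x ∈ Set.Icc (0 : ℝ) 1) ∧ ∀ x ∈ K, φ x = 1 := by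
  obtain ⟨δ, hδ, hsub⟩ := hK.exists_cthickening_subset_open hΩ hKΩ
  obtain ⟨φ, h1, h2, h3, h4⟩ := exists_contMDiff_support_eq_eq_one_iff
    (modelWithCornersSelf ℝ (Pt d)) (n := (⊤ : ℕ∞)) (Metric.isOpen_thickening (δ := δ) (E := K)) hK.isClosed
    (Metric.self_subset_thickening hδ K)
  have hts : tsupport φ ⊆ Metric.cthickening δ K := by
    rw [tsupport, h3]
    exact Metric.closure_thickening_subset_cthickening δ K
  exact ⟨φ, h1.contDiff, hK.cthickening.of_isClosed_subset (isClosed_tsupport φ) hts,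
    hts.trans hsub, fun x => h2 (Set.mem_range_self x), fun x hx => (h4 x).1 hx⟩

/-- As φ is supported in Ω, the integrals extend to the whole space and no boundary term arises for
any test function, which settles the trace condition as well. -/
theorem memHGamma_single {φ : Pt d → ℝ} (hφ : ContDiff ℝ ∞ φ) (hc : HasCompactSupport φ)
    (hs : tsupport φ ⊆ Ω) (i : Fin d) : MemHGamma Ω Γ₁ fun x => Pi.single i (φ x) := by
  have hφ' : Continuous (fderiv ℝ φ) := hφ.continuous_fderiv (by simp)
  have hD : ∀ b, Continuous fun x => fderiv ℝ φ x (EuclideanSpace.single b 1) := fun b => by fun_prop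
  have hDc : ∀ b, HasCompactSupport fun x => fderiv ℝ φ x (EuclideanSpace.single b 1) := fun b =>
    hc.fderiv_apply (𝕜 := ℝ) _
  have hparts : ∀ ψ : Pt d → ℝ, ContDiff ℝ ∞ ψ → HasCompactSupport ψ →
      IntegratesByParts Ω (fun x => Pi.single i (φ x))
        (fun x => Matrix.of fun a b => if a = i then fderiv ℝ φ x (EuclideanSpace.single b 1) else 0)
        ψ := by
    intro ψ hψ hψc a b
    by_cases hai : a = i
    · subst hai
      have hψ' : Continuous (fderiv ℝ ψ) := hψ.continuous_fderiv (by simp)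
      have hE : Continuous fun x => fderiv ℝ ψ x (EuclideanSpace.single b 1) := by fun_prop
      simp only [Pi.single_eq_same, Matrix.of_apply, if_true]
      rw [setIntegral_eq_integral_of_forall_compl_eq_zero,
        setIntegral_eq_integral_of_forall_compl_eq_zero]
      · exact integral_mul_fderiv_eq_neg_fderiv_mul_of_integrable
          (((hD b).mul hψ.continuous).integrable_of_hasCompactSupport (hDc b).mul_right)
          ((hφ.continuous.mul hE).integrable_of_hasCompactSupport hc.mul_right)
          ((hφ.continuous.mul hψ.continuous).integrable_of_hasCompactSupport hc.mul_right)
          (fun x _ => (hφ.differentiable (by simp)) x) (fun x _ => (hψ.differentiable (by simp)) x)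
      · intro x hx
        have : fderiv ℝ φ x = 0 := by
          by_contra hne
          exact hx (hs (support_fderiv_subset ℝ hne))
        rw [this]; simp
      · intro x hx
        rw [image_eq_zero_of_notMem_tsupport fun h => hx (hs h), zero_mul]
    · simp [hai]
  refine ⟨fun a => ?_, _, fun a b => ?_, fun ψ h1 h2 _ => hparts ψ h1 h2,
    fun ψ h1 h2 _ => hparts ψ h1 h2⟩
  · by_cases hai : a = i
    · subst hai
      simpa using (hφ.continuous.memLp_of_hasCompactSupport hc).restrict Ω
    · simp [hai]
  · by_cases hai : a = i
    · subst hai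
      simpa using ((hD b).memLp_of_hasCompactSupport (hDc b)).restrict Ω
    · simp [hai]

end Cutoff

/-! ### Integrability of the inverse permeability -/

section Permeability

variable {d : ℕ} {Ω Γ₁ : Set (Pt d)} {perm : Pt d → Matrix (Fin d) (Fin d) ℝ} {κlo κup : ℝ}

theorem IsPermeability.aemeasurable_inv (h : IsPermeability Ω Γ₁ perm κlo κup) (i j : Fin d) :
    AEMeasurable (fun x => (perm x)⁻¹ i j) (volume.restrict Ω) := by
  have h1 : AEMeasurable (fun x i j => perm x i j) (volume.restrict Ω) :=
    aemeasurable_pi_iff.2 fun i => aemeasurable_pi_iff.2 fun j => h.measurable i j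
  exact (measurable_inv_apply i j).comp_aemeasurable h1

theorem IsPermeability.ae_diag_inv_nonneg (h : IsPermeability Ω Γ₁ perm κlo κup) (i : Fin d) :
    ∀ᵐ x ∂(volume.restrict Ω), 0 ≤ (perm x)⁻¹ i i := by
  filter_upwards [h.posDef] with x hx
  exact hx.inv.posSemidef.diag_nonneg

/-- The upper bound is tested with φ e_i, where φ is a cutoff equal to 1 on K. What matters is that
the resulting bound does not depend on K. -/
theorem IsPermeability.setLIntegral_diag_inv_le (h : IsPermeability Ω Γ₁ perm κlo κup)
    (hΩ : IsOpen Ω) (hfin : volume Ω < ⊤) {K : Set (Pt d)} (hK : IsCompact K) (hKΩ : K ⊆ Ω)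
    (i : Fin d) :
    ∫⁻ x in K, ENNReal.ofReal ((perm x)⁻¹ i i) ≤ ENNReal.ofReal (κup * volume.real Ω) := by
  obtain ⟨φ, hφ, hc, hs, h01, h1⟩ := exists_smooth_cutoff hK hΩ hKΩ
  have hmem : MemHGamma Ω Γ₁ fun x => Pi.single i (φ x) := memHGamma_single hφ hc hs i
  have hlo := h.lower _ hmem
  have hup := h.upper _ hmem
  have e1 : ∀ x, (Pi.single i (φ x) : Fin d → ℝ) ⬝ᵥ Pi.single i (φ x) = φ x ^ 2 := by
    intro x; simp [sq]
  have e2 : ∀ x, ((perm x)⁻¹ *ᵥ Pi.single i (φ x)) ⬝ᵥ (Pi.single i (φ x) : Fin d → ℝ) =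
      φ x ^ 2 * (perm x)⁻¹ i i := by
    intro x; simp [mulVec_single, sq]; ring
  simp only [e1, e2] at hlo hup
  have hsq : ∀ x, φ x ^ 2 ≤ 1 := fun x => pow_le_one₀ (h01 x).1 (h01 x).2
  have hφi : Integrable (fun x => φ x ^ 2) (volume.restrict Ω) := by
    have hcs : HasCompactSupport fun x => φ x ^ 2 := by
      simp only [sq]; exact hc.mul_right
    exact ((hφ.continuous.pow 2).integrable_of_hasCompactSupport hcs).restrict
  have hae := h.ae_diag_inv_nonneg i
  rcases (setIntegral_nonneg_of_ae (Filter.Eventually.of_forall fun x =>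
    sq_nonneg (φ x)) : 0 ≤ ∫ x in Ω, φ x ^ 2).eq_or_lt with h0 | hpos
  · have hz := (integral_eq_zero_iff_of_nonneg (fun x => sq_nonneg (φ x)) hφi).1 h0.symm
    have hK0 : volume K = 0 := by
      have h2 : volume.restrict Ω K = 0 := by
        refine measure_mono_null (fun x hx => ?_) hz
        simp [h1 x hx]
      rwa [Measure.restrict_apply hK.measurableSet, Set.inter_eq_self_of_subset_left hKΩ] at h2
    rw [Measure.restrict_eq_zero.2 hK0, lintegral_zero_measure]
    exact zero_le
  -- The upper bound carries no information if the integral has the default value 0; the lower bound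
  -- excludes this, since ∫ φ² > 0.
  · have hint : Integrable (fun x => φ x ^ 2 * (perm x)⁻¹ i i) (volume.restrict Ω) := by
      by_contra hni
      rw [integral_undef hni] at hlo
      exact absurd hlo (not_le.2 (mul_pos h.lower_pos hpos))
    calc ∫⁻ x in K, ENNReal.ofReal ((perm x)⁻¹ i i)
        = ∫⁻ x in K, ENNReal.ofReal (φ x ^ 2 * (perm x)⁻¹ i i) := by
          refine setLIntegral_congr_fun hK.measurableSet fun x hx => ?_
          simp [h1 x hx]
      _ ≤ ∫⁻ x in Ω, ENNReal.ofReal (φ x ^ 2 * (perm x)⁻¹ i i) := lintegral_mono_set hKΩ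
      _ = ENNReal.ofReal (∫ x in Ω, φ x ^ 2 * (perm x)⁻¹ i i) := by
          rw [ofReal_integral_eq_lintegral_ofReal hint]
          filter_upwards [hae] with x hx
          exact mul_nonneg (sq_nonneg _) hx
      _ ≤ _ := by
          refine ENNReal.ofReal_le_ofReal (hup.trans (mul_le_mul_of_nonneg_left ?_ h.upper_pos.le))
          have : IsFiniteMeasure (volume.restrict Ω) := ⟨by simpa using hfin⟩
          have := integral_mono hφi (integrable_const (1 : ℝ)) hsq
          simpa using this

/-- Monotone convergence along an exhaustion of Ω by compact sets, with the uniform bound on each of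
them. -/
theorem IsPermeability.integrableOn_diag_inv (h : IsPermeability Ω Γ₁ perm κlo κup)
    (hΩ : IsOpen Ω) (hb : Bornology.IsBounded Ω) (i : Fin d) :
    IntegrableOn (fun x => (perm x)⁻¹ i i) Ω := by
  have hfin : volume Ω < ⊤ := hb.measure_lt_top
  refine ⟨(h.aemeasurable_inv i i).aestronglyMeasurable, ?_⟩
  rw [hasFiniteIntegral_iff_ofReal (h.ae_diag_inv_nonneg i)]
  obtain ⟨F, hFc, hFΩ, hFU, hFm⟩ := hΩ.exists_iUnion_isClosed
  have hle : ∫⁻ x in Ω, ENNReal.ofReal ((perm x)⁻¹ i i) ≤ ENNReal.ofReal (κup * volume.real Ω) := by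
    conv_lhs => rw [← hFU]
    rw [setLIntegral_iUnion_of_directed _ (hFm.directed_le)]
    exact iSup_le fun m => h.setLIntegral_diag_inv_le hΩ hfin
      (Metric.isCompact_of_isClosed_isBounded (hFc m) (hb.subset (hFΩ m))) (hFΩ m) i
  exact hle.trans_lt ENNReal.ofReal_lt_top

theorem IsPermeability.integrableOn_inv (h : IsPermeability Ω Γ₁ perm κlo κup)
    (hΩ : IsOpen Ω) (hb : Bornology.IsBounded Ω) (i j : Fin d) :
    IntegrableOn (fun x => (perm x)⁻¹ i j) Ω := by
  refine ((h.integrableOn_diag_inv hΩ hb i).add (h.integrableOn_diag_inv hΩ hb j)).mono'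
    (h.aemeasurable_inv i j).aestronglyMeasurable ?_
  filter_upwards [h.posDef] with x hx
  exact abs_apply_le_of_posDef hx.inv i j

end Permeability

/-! ### Elements inside the domain and the lower bound of the permeability form -/

section Elements

variable {d : ℕ} {Ω Γ₁ : Set (Pt d)}

/-- A Lipschitz domain lies on one side of its boundary: just below a boundary point, against the
direction e, there is an open set that misses Ω. So no slit can be filled in by taking the closure.
-/
theorem HasLipschitzBoundary.interior_closure_subset (hΩL : HasLipschitzBoundary Ω)
    (hΩ : IsOpen Ω) : interior (closure Ω) ⊆ Ω := by
  intro x hx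
  by_contra hxΩ
  have hfr : x ∈ frontier Ω := ⟨interior_subset hx, by rwa [hΩ.interior_eq]⟩
  obtain ⟨e, he, r, hr, L, γ, hγ, hγe, hloc⟩ := hΩL x hfr
  have hee : inner ℝ e e = (1 : ℝ) := by rw [real_inner_self_eq_norm_sq, he, one_pow]
  have hle : inner ℝ e x ≤ γ x := by
    by_contra hlt
    exact hxΩ ((hloc x (Metric.mem_ball_self hr)).2 (not_le.1 hlt))
  have hcont : Filter.Tendsto (fun τ : ℝ => x + (-τ) • e) (nhdsWithin 0 (Set.Ioi 0)) (nhds x) := by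
    have : Continuous fun τ : ℝ => x + (-τ) • e := by fun_prop
    simpa using (this.tendsto 0).mono_left nhdsWithin_le_nhds
  obtain ⟨τ, ⟨h1, h2⟩, h3⟩ := ((hcont.eventually (isOpen_interior.mem_nhds hx)).and
    (hcont.eventually (Metric.isOpen_ball.mem_nhds (Metric.mem_ball_self hr)))).and
    self_mem_nhdsWithin |>.exists
  set y := x + (-τ) • e with hy
  have hlow : inner ℝ e y < γ y := by
    rw [hy, hγe, inner_add_right, inner_smul_right, hee]
    have : (0 : ℝ) < τ := h3
    linarith
  have hopen : IsOpen ({z : Pt d | inner ℝ e z < γ z} ∩ Metric.ball x r) :=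
    (isOpen_lt (by fun_prop) hγ.continuous).inter Metric.isOpen_ball
  obtain ⟨z, hz, hzΩ⟩ := mem_closure_iff.1 (interior_subset h1) _ hopen ⟨hlow, h2⟩
  exact absurd ((hloc z hz.2).1 hzΩ) (not_lt.2 (le_of_lt hz.1))

/-- Transfers almost everywhere statements and integrability from Ω to each element; the frontier of
a convex set is null. -/
theorem restrict_closedInterior_le (hΩL : HasLipschitzBoundary Ω) (hΩ : IsOpen Ω) (𝒯 : Mesh Ω)
    {T : Affine.Simplex ℝ (Pt d) d} (hT : T ∈ 𝒯.elems) :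
    (volume.restrict T.closedInterior : Measure (Pt d)) ≤ volume.restrict Ω := by
  have hsub : interior T.closedInterior ⊆ Ω := by
    refine (interior_mono ?_).trans (hΩL.interior_closure_subset hΩ)
    rw [← 𝒯.cover]
    exact Set.subset_biUnion_of_mem (u := fun T : Affine.Simplex ℝ (Pt d) d => T.closedInterior) hT
  have hae : (T.closedInterior : Set (Pt d)) =ᵐ[volume] interior T.closedInterior :=
    (interior_ae_eq_of_null_frontier ((convex_closedInterior T).addHaar_frontier volume)).symm
  rw [Measure.restrict_congr_set hae]
  exact Measure.restrict_mono hsub le_rfl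

theorem continuous_eval_polynomial (p : MvPolynomial (Fin d) ℝ) :
    Continuous fun x : Pt d => MvPolynomial.eval (fun l => x l) p :=
  (MvPolynomial.continuous_eval p).comp (PiLp.continuous_ofLp 2 _)

theorem Velocity.continuous_val {𝒯 : Mesh Ω} {k : ℕ} (v : Velocity 𝒯 k) (T : 𝒯.elems) :
    Continuous (v.val T) :=
  continuous_pi fun _ => continuous_eval_polynomial _

theorem exists_aPerm_lower_bound (hd : 0 < d) (hΩ : IsOpen Ω) (hb : Bornology.IsBounded Ω)
    (hΩL : HasLipschitzBoundary Ω) {perm : Pt d → Matrix (Fin d) (Fin d) ℝ} {κlo κup : ℝ}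
    (h : IsPermeability Ω Γ₁ perm κlo κup) : ∃ c : ℝ, 0 < c ∧
      ∀ (𝒯 : Mesh Ω) (k : ℕ) (v : Velocity 𝒯 k),
        c * brokenIntegral 𝒯 (fun T x => v.val T x ⬝ᵥ v.val T x) ≤ aPerm perm v v := by
  obtain ⟨M₀, hM₀⟩ := h.bounded
  -- The maximum with 1 ensures dM > 0, so that the constant (dM)⁻¹ is positive.
  set M : ℝ := max M₀ 1 with hM
  have hdM : (0 : ℝ) < d * M :=
    mul_pos (Nat.cast_pos.2 hd) (zero_lt_one.trans_le (le_max_right _ _))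
  refine ⟨(d * M)⁻¹, inv_pos.2 hdM, fun 𝒯 k v => ?_⟩
  rw [aPerm, brokenIntegral, brokenIntegral, Finset.mul_sum]
  refine Finset.sum_le_sum fun T _ => ?_
  have hle := restrict_closedInterior_le hΩL hΩ 𝒯 T.2
  have hcomp := T.1.isCompact_closedInterior
  have hval := v.continuous_val T
  rw [← integral_const_mul]
  refine integral_mono_ae ?_ ?_ ?_
  · exact (continuous_const.mul (hval.dotProduct hval)).continuousOn.integrableOn_compact hcomp
  · have e : (fun x => ((perm x)⁻¹ *ᵥ v.val T x) ⬝ᵥ v.val T x) =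
        fun x => ∑ i, ∑ j, (v.val T x j * v.val T x i) * (perm x)⁻¹ i j := by
      funext x
      simp only [dotProduct, mulVec, Finset.sum_mul]
      exact Finset.sum_congr rfl fun i _ => Finset.sum_congr rfl fun j _ => by ring
    rw [e]
    refine integrable_finsetSum _ fun i _ => integrable_finsetSum _ fun j _ => ?_
    have hc : Continuous fun x => v.val T x j * v.val T x i :=
      ((continuous_apply j).comp hval).mul ((continuous_apply i).comp hval)
    exact IntegrableOn.continuousOn_mul hc.continuousOn
      (Integrable.mono_measure (h.integrableOn_inv hΩ hb i j) hle) hcomp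
  · have hP : ∀ᵐ x ∂(volume.restrict Ω), ∀ u : Fin d → ℝ,
        (d * M)⁻¹ * (u ⬝ᵥ u) ≤ ((perm x)⁻¹ *ᵥ u) ⬝ᵥ u := by
      filter_upwards [h.posDef, hM₀] with x hx hMx u
      rw [inv_mul_le_iff₀ hdM]
      exact dotProduct_self_le_of_posDef hx (fun i j => (hMx i j).trans (le_max_left _ _)) hdM u
    filter_upwards [ae_mono hle hP] with x hx
    exact hx _

end Elements

/-! ### Skeleton integrals -/

section Frob

variable {d : ℕ}

theorem frob_self_nonneg (A : Matrix (Fin d) (Fin d) ℝ) : 0 ≤ frob A A :=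
  Finset.sum_nonneg fun _ _ => Finset.sum_nonneg fun _ _ => mul_self_nonneg _

theorem abs_frob_le (A B : Matrix (Fin d) (Fin d) ℝ) {t : ℝ} (ht : 0 < t) :
    |frob A B| ≤ (t * frob A A + t⁻¹ * frob B B) / 2 := by
  have h : ∀ a b : ℝ, |a * b| ≤ (t * (a * a) + t⁻¹ * (b * b)) / 2 := by
    intro a b
    have h1 : 0 ≤ t⁻¹ * (t * |a| - |b|) ^ 2 := by positivity
    have h2 : t⁻¹ * (t * |a| - |b|) ^ 2 = t * (a * a) + t⁻¹ * (b * b) - 2 * (|a| * |b|) := by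
      rw [← abs_mul_abs_self a, ← abs_mul_abs_self b]
      field_simp
      ring
    rw [abs_mul]
    linarith
  refine (Finset.abs_sum_le_sum_abs _ _).trans ?_
  refine (Finset.sum_le_sum fun i _ => (Finset.abs_sum_le_sum_abs _ _).trans
    (Finset.sum_le_sum fun j _ => h (A i j) (B i j))).trans_eq ?_
  simp only [frob, ← Finset.sum_div, Finset.sum_add_distrib, ← Finset.mul_sum]

theorem frob_smul_left (c : ℝ) (A B : Matrix (Fin d) (Fin d) ℝ) :
    frob (c • A) B = c * frob A B := by
  simp only [frob, Matrix.smul_apply, smul_eq_mul, Finset.mul_sum, mul_assoc]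

/-- Cauchy–Schwarz, with the gain 1/card discarded. No knowledge of the number of adjacent elements
is required, and the empty set is covered by 0⁻¹ = 0. -/
theorem frob_average_le {β : Type*} (s : Finset β) (A : β → Matrix (Fin d) (Fin d) ℝ) :
    frob ((s.card : ℝ)⁻¹ • ∑ b ∈ s, A b) ((s.card : ℝ)⁻¹ • ∑ b ∈ s, A b) ≤
      ∑ b ∈ s, frob (A b) (A b) := by
  have h : ∀ i j, ((s.card : ℝ)⁻¹ • ∑ b ∈ s, A b) i j * ((s.card : ℝ)⁻¹ • ∑ b ∈ s, A b) i j ≤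
      ∑ b ∈ s, A b i j * A b i j := by
    intro i j
    rcases s.eq_empty_or_nonempty with rfl | hne
    · simp
    have hc : (1 : ℝ) ≤ s.card := by exact_mod_cast hne.card_pos
    have h1 := sq_sum_le_card_mul_sum_sq (s := s) (f := fun b => A b i j)
    have h2 : 0 ≤ ∑ b ∈ s, A b i j ^ 2 := Finset.sum_nonneg fun _ _ => sq_nonneg _
    rw [Matrix.smul_apply, Matrix.sum_apply, smul_eq_mul]
    simp only [← sq] at *
    rw [mul_pow, inv_pow, inv_mul_le_iff₀ (by positivity)]
    nlinarith
  unfold frob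
  calc _ ≤ ∑ i, ∑ j, ∑ b ∈ s, A b i j * A b i j :=
        Finset.sum_le_sum fun i _ => Finset.sum_le_sum fun j _ => h i j
    _ = _ := by
        symm
        rw [Finset.sum_comm]
        refine Finset.sum_congr rfl fun i _ => ?_
        rw [Finset.sum_comm]

theorem continuous_frob {X : Type*} [TopologicalSpace X] {A B : X → Matrix (Fin d) (Fin d) ℝ}
    (hA : Continuous A) (hB : Continuous B) : Continuous fun x => frob (A x) (B x) := by
  unfold frob
  exact continuous_finsetSum _ fun i _ => continuous_finsetSum _ fun j _ =>
    (hA.matrix_elem i j).mul (hB.matrix_elem i j)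

end Frob

/-! ### Gradient averages and jumps on the skeleton -/

section Skeleton

variable {d : ℕ} {Ω Γ₁ : Set (Pt d)} {𝒯 : Mesh Ω} {k : ℕ}

theorem Velocity.continuous_grad (v : Velocity 𝒯 k) (T : 𝒯.elems) : Continuous (v.grad T) :=
  continuous_matrix fun _ _ => continuous_eval_polynomial _

theorem Velocity.continuous_jump (v : Velocity 𝒯 k) (F : Set (Pt d)) : Continuous (v.jump F) :=
  continuous_finsetSum _ fun T _ => continuous_matrix fun i _ =>
    ((continuous_apply i).comp (v.continuous_val T)).mul continuous_const

theorem Velocity.continuous_meanGrad (v : Velocity 𝒯 k) (F : Set (Pt d)) :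
    Continuous (v.meanGrad F) := by
  change Continuous fun x => ((𝒯.adjacent F).card : ℝ)⁻¹ • ∑ T ∈ 𝒯.adjacent F, v.grad T x
  exact (continuous_finsetSum _ fun T _ => v.continuous_grad T).const_smul ((𝒯.adjacent F).card : ℝ)⁻¹

theorem Mesh.isCompact_of_mem_activeFacets {F : Set (Pt d)} (hF : F ∈ 𝒯.activeFacets Γ₁) :
    IsCompact F := by
  rcases 𝒯.mem_activeFacets.1 hF with ⟨-, T, -, T', -, -, rfl⟩ | ⟨⟨-, T, -, i, rfl⟩, -⟩
  · exact T.isCompact_closedInterior.inter_right T'.isClosed_closedInterior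
  · exact isCompact_simplexFacet T i

theorem Mesh.measure_lt_top_of_mem_activeFacets [NeZero d] {F : Set (Pt d)}
    (hF : F ∈ 𝒯.activeFacets Γ₁) : μHE[d - 1] F < ⊤ := by
  have hc := 𝒯.isCompact_of_mem_activeFacets hF
  rcases 𝒯.mem_activeFacets.1 hF with ⟨-, T, hT, T', hT', hne, rfl⟩ | ⟨⟨-, T, -, i, rfl⟩, -⟩
  · exact measure_lt_top_of_disjoint_interior T
      ((convex_closedInterior T).inter (convex_closedInterior T')) hc Set.inter_subset_left
      ((disjoint_interior_closedInterior (𝒯.disjoint_interior T hT T' hT' hne)).mono_right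
        Set.inter_subset_right)
  · exact measure_lt_top_of_disjoint_interior T (convex_simplexFacet T i) hc
      (simplexFacet_subset T i) (disjoint_interior_simplexFacet T i)

theorem Mesh.integrableOn_of_mem_activeFacets [NeZero d] {F : Set (Pt d)}
    (hF : F ∈ 𝒯.activeFacets Γ₁) {f : Pt d → ℝ} (hf : Continuous f) :
    IntegrableOn f F μHE[d - 1] := by
  have hc := 𝒯.isCompact_of_mem_activeFacets hF
  obtain ⟨C, hC⟩ := hc.exists_bound_of_continuousOn hf.continuousOn
  exact Measure.integrableOn_of_bounded (M := C) (𝒯.measure_lt_top_of_mem_activeFacets hF).ne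
    hf.measurable.aestronglyMeasurable
    ((ae_restrict_iff' hc.measurableSet).2 (Filter.Eventually.of_forall hC))

/-- Disposes of facets on which the weight `(Metric.diam F)⁻¹` takes the default value 0. For d = 1
a point would have positive measure. -/
theorem measure_eq_zero_of_diam_eq_zero (hd : 2 ≤ d) {F : Set (Pt d)} (hF : IsCompact F)
    (h0 : Metric.diam F = 0) : μHE[d - 1] F = 0 := by
  have hsub : F.Subsingleton := fun x hx y hy =>
    dist_le_zero.1 ((Metric.dist_le_diam_of_mem hF.isBounded hx hy).trans_eq h0)
  have hpos : (0 : ℝ) < ((d - 1 : ℕ) : ℝ) := by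
    have : 0 < d - 1 := by omega
    exact_mod_cast this
  have := Measure.nullSingletonClass_hausdorff (Pt d) hpos
  rw [Measure.euclideanHausdorffMeasure_def, Measure.smul_apply, hsub.measure_zero, smul_zero]

theorem totalDegree_pderiv_le (p : MvPolynomial (Fin d) ℝ) (j : Fin d) :
    (MvPolynomial.pderiv j p).totalDegree ≤ p.totalDegree := by
  conv_lhs => rw [p.as_sum, map_sum]
  refine MvPolynomial.totalDegree_finsetSum_le fun m hm => ?_
  rw [MvPolynomial.pderiv_monomial]
  refine (MvPolynomial.totalDegree_monomial_le _ _).trans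
    (le_trans ?_ (MvPolynomial.le_totalDegree hm))
  exact Finsupp.sum_le_sum_index tsub_le_self (fun _ _ => monotone_id) (by simp)

-- The scalar trace inequality is applied to each entry of the gradient, a polynomial of degree at
-- most k, and the results are summed.
open Classical in
theorem exists_element_trace_constant_grad (d k : ℕ) [NeZero d] (σ : ℝ) (hσ : 0 < σ) :
    ∃ C : ℝ, 0 < C ∧ ∀ (Ω Γ₁ : Set (Pt d)) (𝒯 : Mesh Ω), 𝒯.IsShapeRegular σ →
      ∀ (v : Velocity 𝒯 k) (T : 𝒯.elems),
      ∑ F ∈ (𝒯.activeFacets Γ₁).filter (· ⊆ T.1.closedInterior), Metric.diam F *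
        ∫ x in F, frob (v.grad T x) (v.grad T x) ∂μHE[d - 1] ≤
      C * ∫ x in T.1.closedInterior, frob (v.grad T x) (v.grad T x) := by
  obtain ⟨C, hC, htr⟩ := exists_element_trace_constant d k σ hσ
  refine ⟨C, hC, fun Ω Γ₁ 𝒯 hreg v T => ?_⟩
  have hpoly : ∀ i j, ∑ F ∈ (𝒯.activeFacets Γ₁).filter (· ⊆ T.1.closedInterior), Metric.diam F *
        ∫ x in F, v.grad T x i j * v.grad T x i j ∂μHE[d - 1] ≤
      C * ∫ x in T.1.closedInterior, v.grad T x i j * v.grad T x i j := by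
    intro i j
    have hdeg : (MvPolynomial.pderiv j (v T i).1).totalDegree ≤ k :=
      (totalDegree_pderiv_le _ _).trans
        (MvPolynomial.mem_restrictTotalDegree _ _ _ |>.1 (v T i).2)
    have h := htr Ω Γ₁ 𝒯 hreg T.1 T.2 _ hdeg
    have hcont : Continuous fun x => v.grad T x i j * v.grad T x i j :=
      ((v.continuous_grad T).matrix_elem i j).mul ((v.continuous_grad T).matrix_elem i j)
    have e : ∀ x : Pt d, MvPolynomial.eval (fun l => x l) (MvPolynomial.pderiv j (v T i).1) ^ 2 =
        v.grad T x i j * v.grad T x i j := fun x => sq _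
    simp only [e] at h
    have hnn : ∀ x, 0 ≤ v.grad T x i j * v.grad T x i j := fun x => mul_self_nonneg _
    have hF : ∀ F ∈ (𝒯.activeFacets Γ₁).filter (· ⊆ T.1.closedInterior),
        ENNReal.ofReal (Metric.diam F) *
          ∫⁻ x in F, ENNReal.ofReal (v.grad T x i j * v.grad T x i j) ∂μHE[d - 1] =
        ENNReal.ofReal (Metric.diam F * ∫ x in F, v.grad T x i j * v.grad T x i j ∂μHE[d - 1]) := by
      intro F hF
      rw [ENNReal.ofReal_mul Metric.diam_nonneg, ofReal_integral_eq_lintegral_ofReal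
        (𝒯.integrableOn_of_mem_activeFacets (Finset.mem_filter.1 hF).1 hcont)
        (Filter.Eventually.of_forall hnn)]
    rw [Finset.sum_congr rfl hF, ← ENNReal.ofReal_sum_of_nonneg fun F _ =>
        mul_nonneg Metric.diam_nonneg (integral_nonneg hnn),
      ← ofReal_integral_eq_lintegral_ofReal
        (hcont.continuousOn.integrableOn_compact T.1.isCompact_closedInterior)
        (Filter.Eventually.of_forall hnn), ← ENNReal.ofReal_mul hC.le] at h
    exact (ENNReal.ofReal_le_ofReal_iff (mul_nonneg hC.le (integral_nonneg hnn))).1 h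
  have hcont : ∀ i j, Continuous fun x => v.grad T x i j * v.grad T x i j := fun i j =>
    ((v.continuous_grad T).matrix_elem i j).mul ((v.continuous_grad T).matrix_elem i j)
  have e1 : ∀ F ∈ (𝒯.activeFacets Γ₁).filter (· ⊆ T.1.closedInterior), Metric.diam F *
        ∫ x in F, frob (v.grad T x) (v.grad T x) ∂μHE[d - 1] =
      ∑ i, ∑ j, Metric.diam F * ∫ x in F, v.grad T x i j * v.grad T x i j ∂μHE[d - 1] := by
    intro F hF
    have hint : ∀ i j, Integrable (fun x => v.grad T x i j * v.grad T x i j)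
        (μHE[d - 1].restrict F) := fun i j =>
      𝒯.integrableOn_of_mem_activeFacets (Finset.mem_filter.1 hF).1 (hcont i j)
    simp only [frob]
    rw [integral_finsetSum _ fun i _ => integrable_finsetSum _ fun j _ => hint i j, Finset.mul_sum]
    refine Finset.sum_congr rfl fun i _ => ?_
    rw [integral_finsetSum _ fun j _ => hint i j, Finset.mul_sum]
  have e2 : ∫ x in T.1.closedInterior, frob (v.grad T x) (v.grad T x) =
      ∑ i, ∑ j, ∫ x in T.1.closedInterior, v.grad T x i j * v.grad T x i j := by
    have hint : ∀ i j, Integrable (fun x => v.grad T x i j * v.grad T x i j)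
        (volume.restrict T.1.closedInterior) := fun i j =>
      (hcont i j).continuousOn.integrableOn_compact T.1.isCompact_closedInterior
    simp only [frob]
    rw [integral_finsetSum _ fun i _ => integrable_finsetSum _ fun j _ => hint i j]
    exact Finset.sum_congr rfl fun i _ => integral_finsetSum _ fun j _ => hint i j
  rw [Finset.sum_congr rfl e1, e2, Finset.sum_comm, Finset.mul_sum]
  refine Finset.sum_le_sum fun i _ => ?_
  rw [Finset.sum_comm, Finset.mul_sum]
  exact Finset.sum_le_sum fun j _ => hpoly i j

/-- The weighted averages of the gradient on the skeleton are controlled by the broken gradient. -/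
theorem exists_mean_grad_bound (d k : ℕ) [NeZero d] (σ : ℝ) (hσ : 0 < σ) :
    ∃ C : ℝ, 0 < C ∧ ∀ (Ω Γ₁ : Set (Pt d)) (𝒯 : Mesh Ω), 𝒯.IsShapeRegular σ → ∀ v : Velocity 𝒯 k,
      ∑ F ∈ 𝒯.activeFacets Γ₁,
        Metric.diam F * ∫ x in F, frob (v.meanGrad F x) (v.meanGrad F x) ∂μHE[d - 1] ≤
      C * brokenIntegral 𝒯 fun T x => frob (v.grad T x) (v.grad T x) := by
  classical
  obtain ⟨C, hC, htr⟩ := exists_element_trace_constant_grad d k σ hσ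
  refine ⟨C, hC, fun Ω Γ₁ 𝒯 hreg v => ?_⟩
  calc _ ≤ ∑ F ∈ 𝒯.activeFacets Γ₁, ∑ T ∈ 𝒯.adjacent F,
        Metric.diam F * ∫ x in F, frob (v.grad T x) (v.grad T x) ∂μHE[d - 1] := by
        refine Finset.sum_le_sum fun F hF => ?_
        have hint : ∀ T, Integrable (fun x => frob (v.grad T x) (v.grad T x))
            (μHE[d - 1].restrict F) := fun T => 𝒯.integrableOn_of_mem_activeFacets hF
          (continuous_frob (v.continuous_grad T) (v.continuous_grad T))
        rw [← Finset.mul_sum, ← integral_finsetSum _ fun T _ => hint T]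
        refine mul_le_mul_of_nonneg_left (integral_mono ?_ ?_ fun x => ?_) Metric.diam_nonneg
        · exact 𝒯.integrableOn_of_mem_activeFacets hF
            (continuous_frob (v.continuous_meanGrad F) (v.continuous_meanGrad F))
        · exact integrable_finsetSum _ fun T _ => hint T
        · exact frob_average_le (𝒯.adjacent F) fun T => v.grad T x
    _ = ∑ T : 𝒯.elems, ∑ F ∈ (𝒯.activeFacets Γ₁).filter (· ⊆ T.1.closedInterior),
        Metric.diam F * ∫ x in F, frob (v.grad T x) (v.grad T x) ∂μHE[d - 1] := by
        -- Double counting: T is adjacent to F exactly when F ⊆ T.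
        refine Finset.sum_comm' fun F T => ?_
        simp [Mesh.adjacent]
    _ ≤ _ := by
        rw [brokenIntegral, Finset.mul_sum]
        exact Finset.sum_le_sum fun T _ => htr Ω Γ₁ 𝒯 hreg v T

/-- The consistency term is controlled by the average and jump terms. -/
theorem abs_skeletonIntegral_le (hd : 2 ≤ d) (Γ₁ : Set (Pt d)) {ν : ℝ} (hν : 0 < ν) {δ : ℝ}
    (hδ : 0 < δ) (v : Velocity 𝒯 k) :
    |skeletonIntegral 𝒯 Γ₁ fun F x => frob (ν • v.meanGrad F x) (v.jump F x)| ≤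
      ν / 2 * (δ * ∑ F ∈ 𝒯.activeFacets Γ₁,
          Metric.diam F * ∫ x in F, frob (v.meanGrad F x) (v.meanGrad F x) ∂μHE[d - 1] +
        δ⁻¹ * skeletonIntegral 𝒯 Γ₁ fun F x =>
          (Metric.diam F)⁻¹ * frob (v.jump F x) (v.jump F x)) := by
  have : NeZero d := ⟨by omega⟩
  rw [skeletonIntegral, skeletonIntegral, Finset.mul_sum, Finset.mul_sum, ← Finset.sum_add_distrib,
    Finset.mul_sum]
  refine (Finset.abs_sum_le_sum_abs _ _).trans (Finset.sum_le_sum fun F hF => ?_)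
  rcases (Metric.diam_nonneg (s := F)).eq_or_lt with h0 | hpos
  · have hz := measure_eq_zero_of_diam_eq_zero hd (𝒯.isCompact_of_mem_activeFacets hF) h0.symm
    simp [Measure.restrict_eq_zero.2 hz]
  · have hm := 𝒯.integrableOn_of_mem_activeFacets hF
      (continuous_frob (v.continuous_meanGrad F) (v.continuous_meanGrad F))
    have hj := 𝒯.integrableOn_of_mem_activeFacets hF
      (continuous_frob (v.continuous_jump F) (v.continuous_jump F))
    have hmj := 𝒯.integrableOn_of_mem_activeFacets hF
      (continuous_frob (v.continuous_meanGrad F) (v.continuous_jump F))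
    simp only [frob_smul_left]
    rw [integral_const_mul, integral_const_mul, abs_mul, abs_of_pos hν, div_mul_eq_mul_div,
      mul_div_assoc]
    refine mul_le_mul_of_nonneg_left ?_ hν.le
    calc |∫ x in F, frob (v.meanGrad F x) (v.jump F x) ∂μHE[d - 1]|
        ≤ ∫ x in F, |frob (v.meanGrad F x) (v.jump F x)| ∂μHE[d - 1] := abs_integral_le_integral_abs
      _ ≤ ∫ x in F, (δ * Metric.diam F / 2 * frob (v.meanGrad F x) (v.meanGrad F x) +
            (δ * Metric.diam F)⁻¹ / 2 * frob (v.jump F x) (v.jump F x)) ∂μHE[d - 1] := by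
          -- Young's inequality with weight δ·diam F, the scaling shared by the trace inequality and
          -- the penalty.
          refine integral_mono hmj.abs ((hm.const_mul _).add (hj.const_mul _)) fun x => ?_
          refine (abs_frob_le _ _ (mul_pos hδ hpos)).trans_eq ?_
          ring
      _ = _ := by
          rw [integral_add (hm.const_mul _) (hj.const_mul _), integral_const_mul,
            integral_const_mul, mul_inv]
          ring

end Skeleton

end BrinkmanDG

/-! ### Coercivity -/

theorem mainTheorem5 {d : ℕ} (hd : d = 2 ∨ d = 3)
    (Ω Γ₁ Γ₂ : Set (Pt d)) (hΩo : IsOpen Ω) (hΩb : Bornology.IsBounded Ω)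
    (hΩL : HasLipschitzBoundary Ω) (hΓ : IsBoundaryPartition Ω Γ₁ Γ₂)
    (ν : ℝ) (hν : 0 < ν)
    (perm : Pt d → Matrix (Fin d) (Fin d) ℝ) (κlo κup : ℝ)
    (hperm : IsPermeability Ω Γ₁ perm κlo κup)
    (k : ℕ) (hk : 1 ≤ k)
    {ι : Type*} (𝒯 : ι → Mesh Ω)
    (hreg : ∃ σ : ℝ, 0 < σ ∧ ∀ i, (𝒯 i).IsShapeRegular σ)
    (hcomp : ∀ i, (𝒯 i).IsCompatible Γ₁ Γ₂)
    (ε : ℝ) (hε : ε = -1 ∨ ε = 0 ∨ ε = 1) :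
    ∃ aStar : ℝ, 0 < aStar ∧ ∀ aS : ℝ, aStar ≤ aS →
      ∃ α : ℝ, 0 < α ∧ ∀ (i : ι) (v : Velocity (𝒯 i) k), v ∈ discreteKernel (𝒯 i) k Γ₁ →
        α * normSq Γ₁ v ≤ aForm Γ₁ perm ν aS ε v v := by
  have hd2 : 2 ≤ d := by omega
  have : NeZero d := ⟨by omega⟩
  obtain ⟨σ, hσ, hreg⟩ := hreg
  obtain ⟨C, hC, hmean⟩ := exists_mean_grad_bound d k σ hσ
  obtain ⟨c, hc, hlow⟩ := exists_aPerm_lower_bound (by omega) hΩo hΩb hΩL hperm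
  -- With δ = (2C)⁻¹ the consistency terms cost at most (ν/2)G + 2CνJ. Half of the gradient term
  -- remains, and aS ≥ 2C + 1 leaves at least νJ of the penalty.
  refine ⟨2 * C + 1, by positivity, fun aS haS =>
    ⟨min c (ν / 2), lt_min hc (half_pos hν), fun i v _ => ?_⟩⟩
  set V := brokenIntegral (𝒯 i) fun T x => v.val T x ⬝ᵥ v.val T x with hV
  set G := brokenIntegral (𝒯 i) fun T x => frob (v.grad T x) (v.grad T x) with hG
  set J := skeletonIntegral (𝒯 i) Γ₁ fun F x =>
    (Metric.diam F)⁻¹ * frob (v.jump F x) (v.jump F x) with hJ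
  set X := skeletonIntegral (𝒯 i) Γ₁ fun F x => frob (ν • v.meanGrad F x) (v.jump F x) with hX
  have hV0 : 0 ≤ V := Finset.sum_nonneg fun T _ => integral_nonneg fun x =>
    Finset.sum_nonneg fun l _ => mul_self_nonneg _
  have hG0 : 0 ≤ G := Finset.sum_nonneg fun T _ => integral_nonneg fun x => frob_self_nonneg _
  have hJ0 : 0 ≤ J := Finset.sum_nonneg fun F _ => integral_nonneg fun x =>
    mul_nonneg (inv_nonneg.2 Metric.diam_nonneg) (frob_self_nonneg _)
  have hbroken : (brokenIntegral (𝒯 i) fun T x => ν * frob (v.grad T x) (v.grad T x)) = ν * G := by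
    simp only [hG, brokenIntegral, integral_const_mul, Finset.mul_sum]
  have hpenalty : (skeletonIntegral (𝒯 i) Γ₁ fun F x =>
      aS / Metric.diam F * ν * frob (v.jump F x) (v.jump F x)) = aS * ν * J := by
    simp only [hJ, skeletonIntegral, integral_const_mul, Finset.mul_sum]
    exact Finset.sum_congr rfl fun F _ => by ring
  have hform : aForm Γ₁ perm ν aS ε v v = aPerm perm v v + (ν * G + aS * ν * J - X - ε * X) := by
    rw [aForm, aGrad, hbroken, hpenalty]
  have hnorm : normSq Γ₁ v = V + G + J := rfl
  have hXle : |X| ≤ ν / 4 * G + ν * C * J := by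
    have h1 := abs_skeletonIntegral_le hd2 Γ₁ hν (δ := (2 * C)⁻¹) (by positivity) v
    have h2 := mul_le_mul_of_nonneg_left (hmean Ω Γ₁ (𝒯 i) (hreg i) v)
      (by positivity : (0 : ℝ) ≤ (2 * C)⁻¹)
    have h3 : (2 * C)⁻¹ * (C * G) = G / 2 := by field_simp
    rw [inv_inv, ← hX, ← hJ] at h1
    rw [← hG, h3] at h2
    refine h1.trans ((mul_le_mul_of_nonneg_left (add_le_add_left h2 _) (half_pos hν).le).trans_eq ?_)
    ring
  -- Since |1 + ε| ≤ 2, one threshold serves all three values of ε.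
  have hεX : X + ε * X ≤ 2 * |X| := by
    have hX1 := le_abs_self X
    have hX0 := abs_nonneg X
    rcases hε with rfl | rfl | rfl <;> linarith
  have hperm' : min c (ν / 2) * V ≤ aPerm perm v v :=
    (mul_le_mul_of_nonneg_right (min_le_left _ _) hV0).trans (hlow (𝒯 i) k v)
  have hGle : min c (ν / 2) * G ≤ ν / 2 * G := mul_le_mul_of_nonneg_right (min_le_right _ _) hG0
  have hJle : min c (ν / 2) * J ≤ ν * J :=
    mul_le_mul_of_nonneg_right ((min_le_right _ _).trans (by linarith)) hJ0
  have haJ : (2 * C + 1) * (ν * J) ≤ aS * (ν * J) :=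
    mul_le_mul_of_nonneg_right haS (mul_nonneg hν.le hJ0)
  rw [hform, hnorm]
  linarith
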